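/- Let $X\ge 1$ be an integer-valued random variable with $\mathbb P(X>x)=c\,x^{-\alpha}(1+o(1))$ as $x\to\infty$, for some $c,\alpha>0$. Let $\mathcal T$ be the branching process tree with root $\varnothing$ and offspring distribution $X$ (all vertices have independent offspring numbers distributed as $X$), and give its edges $e$ weights $w(e)$ that are i.i.d. uniform on $[0,1]$ and independent of $\mathcal T$. Invasion percolation starts from $T_0=\{\varnothing\}$ and obtains $T_n$ from $T_{n-1}$ by adding the edge of minimal weight among the edges joining a vertex of $T_{n-1}$ to a vertex outside it, together with its endpoint outside; the invasion percolation cluster is $T=\bigcup_n T_n$. Almost surely $T$ contains exactly one infinite path $v_0=\varnothing,v_1,v_2,\dots$ from the root (the backbone), and for every $k\ge0$ the component $\mathcal M_k$ of $\varnothing$ in $T$ after removal of the edge $\{v_k,v_{k+1}\}$ is finite. Let $\beta_i=w(\{v_{i-1},v_i\})$ for $i\ge1$, $W_k=\max_{i>k}\beta_i$, $C_k=\sum_{e\in E(\mathcal M_k)}w(e)$, $C_{-1}=0$ and $B_k=C_k-C_{k-1}$ for $k\ge 0$. Then, for almost every value $(w_k)_{k\ge0}$ of the sequence $(W_k)_{k\ge0}$,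 conditionally on $(W_k)_{k\ge0}=(w_k)_{k\ge0}$ the random variables $(B_i)_{i\ge0}$ are mutually independent. The same holds for the weights of the attached forests without the backbone edges, that is, for $B_0$ and $B_i-\beta_i$, $i\ge1$. -/

import Mathlib

open MeasureTheory ProbabilityTheory Filter Asymptotics

namespace IPC

/-! Deterministic part: a rooted weighted tree in Ulam–Harris coding. A vertex is a list of naturals,
the root is `[]`, and `i :: v` is the `i`-th child of `v` (so the ancestors of `v`, itself included,
are the suffixes of `v`). `X v` is the number of children of `v`, and `w v` is the weight of the edge
between `v ≠ []` and its parent (`w []` plays no role). -/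

/-- `v` is a vertex of the tree with offspring numbers `X`. -/
def InTree (X : List ℕ → ℕ) : List ℕ → Prop
  | [] => True
  | i :: v => InTree X v ∧ i < X v

/-- The vertices of the tree outside `S` that are joined by an edge to a vertex of `S`. -/
def boundary (X : List ℕ → ℕ) (S : Set (List ℕ)) : Set (List ℕ) :=
  {v | InTree X v ∧ v ∉ S ∧ ∃ u ∈ S, ∃ i : ℕ, v = i :: u}

/-- The boundary vertices whose edge to `S` has minimal weight. For pairwise distinct weights (an
almost sure event for i.i.d. uniform weights) there is at most one. -/
def argminBoundary (X : List ℕ → ℕ) (w : List ℕ → ℝ) (S : Set (List ℕ)) : Set (List ℕ) :=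
  {v | v ∈ boundary X S ∧ ∀ u ∈ boundary X S, w v ≤ w u}

/-- The vertex set of the invaded tree after `n` steps of invasion percolation. -/
def invasion (X : List ℕ → ℕ) (w : List ℕ → ℝ) : ℕ → Set (List ℕ)
  | 0 => {[]}
  | n + 1 => invasion X w n ∪ argminBoundary X w (invasion X w n)

/-- The vertex set of the invasion percolation cluster. -/
def cluster (X : List ℕ → ℕ) (w : List ℕ → ℝ) : Set (List ℕ) :=
  ⋃ n, invasion X w n

/-- `b` is an infinite path from the root in the invasion percolation cluster. -/
def IsBackbone (X : List ℕ → ℕ) (w : List ℕ → ℝ) (b : ℕ → List ℕ) : Prop :=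
  b 0 = [] ∧ (∀ k, ∃ i : ℕ, b (k + 1) = i :: b k) ∧ ∀ k, b k ∈ cluster X w

open Classical in
/-- The backbone of the invasion percolation cluster (arbitrary value if there is none). -/
noncomputable def backbone (X : List ℕ → ℕ) (w : List ℕ → ℝ) : ℕ → List ℕ :=
  if h : ∃ b, IsBackbone X w b then h.choose else fun _ => []

/-- The future maximum weight `W_k = max_{i > k} β_i`, where `β_i` is the weight of the edge between
the backbone vertices `i - 1` and `i`. -/
noncomputable def futureMax (X : List ℕ → ℕ) (w : List ℕ → ℝ) (k : ℕ) : ℝ :=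
  sSup ((fun i => w (backbone X w i)) '' Set.Ioi k)

/-- The vertex set of the `k`-cut cluster: the component of the root in the cluster once the edge
between the backbone vertices `k` and `k + 1` is removed, i.e. the vertices of the cluster that do
not descend from the backbone vertex `k + 1`. -/
def cut (X : List ℕ → ℕ) (w : List ℕ → ℝ) (k : ℕ) : Set (List ℕ) :=
  {v | v ∈ cluster X w ∧ ¬ backbone X w (k + 1) <:+ v}

/-- The cumulative weight `C_k` of the edges of the `k`-cut cluster; its edges are those
joining its vertices other than the root to their parents. -/
noncomputable def cutWeight (X : List ℕ → ℕ) (w : List ℕ → ℝ) (k : ℕ) : ℝ :=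
  ∑' v : {v // v ∈ cut X w k ∧ v ≠ []}, w v

/-- `B_k = C_k - C_{k-1}`, with `C_{-1} = 0`. -/
noncomputable def B (X : List ℕ → ℕ) (w : List ℕ → ℝ) : ℕ → ℝ
  | 0 => cutWeight X w 0
  | k + 1 => cutWeight X w (k + 1) - cutWeight X w k

/-- The vertices of the cluster attached via the backbone vertex `k` (that vertex included):
the vertices of the `k`-cut cluster that are not in the `(k-1)`-cut cluster. -/
def attached (X : List ℕ → ℕ) (w : List ℕ → ℝ) : ℕ → Set (List ℕ)
  | 0 => cut X w 0
  | k + 1 => cut X w (k + 1) \ cut X w k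

/-- The cumulative weight of the edges of the forest attached to the backbone vertex `k`, without
the backbone edge that leads to that vertex. -/
noncomputable def forestWeight (X : List ℕ → ℕ) (w : List ℕ → ℝ) (k : ℕ) : ℝ :=
  ∑' v : {v // v ∈ attached X w k ∧ v ≠ backbone X w k}, w v

/-! Probabilistic part. -/

/-- A branching process tree with offspring law `ν` and i.i.d. standard uniform edge weights: all the
offspring numbers `X v` and weights `w v` are mutually independent. -/
structure IsWeightedBPTree {Ω : Type*} [MeasurableSpace Ω] (P : Measure Ω) (ν : Measure ℕ)
    (X : List ℕ → Ω → ℕ) (w : List ℕ → Ω → ℝ) : Prop where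
  measurable_offspring : ∀ v, Measurable (X v)
  measurable_weight : ∀ v, Measurable (w v)
  law_offspring : ∀ v, P.map (X v) = ν
  law_weight : ∀ v, P.map (w v) = volume.restrict (Set.Icc (0 : ℝ) 1)
  indep_offspring : iIndepFun X P
  indep_weight : iIndepFun w P
  indep : IndepFun (fun ω v => X v ω) (fun ω v => w v ω) P

/-- The random variables `Y i` are independent conditionally on `Z = z`, for almost every value `z` of
`Z`: under the regular conditional law of the sequence `Y` given `Z = z`, the coordinates are
mutually independent. -/
def CondIndepGiven {Ω : Type*} [MeasurableSpace Ω] (P : Measure Ω) [IsFiniteMeasure P]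
    (Y : Ω → ℕ → ℝ) (Z : Ω → ℕ → ℝ) : Prop :=
  AEMeasurable Y P ∧ AEMeasurable Z P ∧
    ∀ᵐ z ∂(P.map Z), iIndepFun (fun (i : ℕ) (y : ℕ → ℝ) => y i) (condDistrib Y Z P z)

end IPC

-- Let `thr` be the percolation threshold of the root and let the `gate` of a child be the maximum
-- of the weight of its edge and its own threshold; the threshold is the minimum of the gates of the
-- children (`thr_eq_inf`). The law of `thr` has no atoms (`thr_noAtoms`), so almost surely each
-- vertex has exactly one best child. Beyond an invaded vertex, invasion only uses edges of weight
-- at most the threshold of that vertex (`weight_le_thr`). Hence the backbone is the path of best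
-- children, W_k is the threshold of its k-th vertex (`futureMax_eq`), and the forest attached there
-- consists of the level-W_k clusters in the subtrees of the other children
-- (`mem_cluster_hanging_iff`). Everything is thus a functional of the iterates of `next`, the
-- passage to the subtree of the best child.
--
-- The probabilistic core is `lintegral_forest_next`. The i-th child, with gate z, is best when all
-- other gates exceed z, and the forest weight is then computed at level z from the other subtrees,
-- which are independent of the i-th. So, even when weighted by a function of the forest weight, the
-- law of the best subtree has a density with respect to the law of the unconditioned tree, and this
-- density depends on the subtree only through its gate, which is W_0. Consequently the forest
-- weight, given the best subtree, depends on W_0 only. The weight u of the first backbone edge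
-- enters the density only through W_0 = max(u, W_1); given the thresholds, u equals W_0 if W_0 >
-- W_1 and is uniform on [0, W_1] otherwise. Apart from u the subtree is an unconditioned tree
-- again, and an induction along the backbone (`lintegral_obsProd`) factorises the conditional
-- expectations of products. `ae_iIndepFun_condDistrib` turns this into independence under the
-- regular conditional law, and `condIndepGiven_of_blocks` joins each forest to the backbone edge
-- leading to it.
--
-- For the absence of atoms, θ(p) = P(`thr` ≤ p) is the largest solution of θ = h(pθ) with h =
-- `hitProb`. Strict concavity of h, which needs P(X ≥ 2) > 0, makes θ left-continuous wherever it
-- is positive.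

namespace IPC

open scoped ENNReal

/-! ### Product measures and independence -/

section Product

lemma comap_pi_le_iSup {Ω ι α E : Type*} [mE : MeasurableSpace E] (f : ι → Ω → E) (a : α → ι) :
    MeasurableSpace.comap (fun ω x => f (a x) ω) MeasurableSpace.pi ≤
      ⨆ i ∈ Set.range a, MeasurableSpace.comap (f i) mE := by
  rw [MeasurableSpace.pi, MeasurableSpace.comap_iSup]
  refine iSup_le fun x => ?_
  rw [MeasurableSpace.comap_comp]
  exact le_iSup₂_of_le (f := fun i (_ : i ∈ Set.range a) => MeasurableSpace.comap (f i) mE)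
    (a x) ⟨x, rfl⟩ le_rfl

/-- Subfamilies of an independent family with disjoint index sets are independent. -/
lemma indepFun_of_disjoint_range {Ω ι α β E : Type*} [MeasurableSpace Ω] [MeasurableSpace E]
    {P : Measure Ω} {f : ι → Ω → E} (hf : iIndepFun f P) (hm : ∀ i, Measurable (f i))
    (a : α → ι) (b : β → ι) (hab : Disjoint (Set.range a) (Set.range b)) :
    IndepFun (fun ω x => f (a x) ω) (fun ω y => f (b y) ω) P := by
  have h := indep_iSup_of_disjoint (fun i => (hm i).comap_le) hf.iIndep hab
  exact indep_of_indep_of_le_left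
    (indep_of_indep_of_le_right h (comap_pi_le_iSup f b)) (comap_pi_le_iSup f a)

lemma measurable_update_prod {ι E : Type*} [DecidableEq ι] [MeasurableSpace E] (i : ι) :
    Measurable (fun p : (ι → E) × E => Function.update p.1 i p.2) := by
  refine measurable_pi_iff.2 fun j => ?_
  by_cases h : j = i
  · subst h; simpa using measurable_snd
  · simp only [Function.update_of_ne h]; fun_prop

/-- Resampling one coordinate leaves a product measure invariant. -/
lemma map_update_infinitePi {ι E : Type*} [DecidableEq ι] [MeasurableSpace E] (μ : ι → Measure E)
    [∀ i, IsProbabilityMeasure (μ i)] (i : ι) :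
    ((Measure.infinitePi μ).prod (μ i)).map (fun p => Function.update p.1 i p.2) =
      Measure.infinitePi μ := by
  refine Measure.eq_infinitePi _ fun s A hA => ?_
  rw [Measure.map_apply (measurable_update_prod i) (.pi s.countable_toSet fun j _ => hA j)]
  -- On a finite box, the new coordinate either replaces the factor at `i` by an independent one of
  -- the same law, or is not tested at all.
  by_cases his : i ∈ s
  · have : (fun p : (ι → E) × E => Function.update p.1 i p.2) ⁻¹' (Set.pi s A) =
        (Set.pi (s.erase i : Finset ι) A) ×ˢ A i := by
      ext p
      simp only [Set.mem_preimage, Set.mem_pi, Set.mem_prod, Finset.mem_coe, Finset.mem_erase]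
      constructor
      · intro h
        refine ⟨fun j hj => ?_, by simpa using h i his⟩
        simpa [Function.update_of_ne hj.1] using h j hj.2
      · rintro ⟨h1, h2⟩ j hj
        by_cases h : j = i
        · subst h; simpa using h2
        · simpa [Function.update_of_ne h] using h1 j ⟨h, hj⟩
    rw [this, Measure.prod_prod, Measure.infinitePi_pi _ fun j _ => hA j,
      Finset.prod_erase_mul _ _ his]
  · have : (fun p : (ι → E) × E => Function.update p.1 i p.2) ⁻¹' (Set.pi s A) =
        (Set.pi s A) ×ˢ Set.univ := by
      ext p
      simp only [Set.mem_preimage, Set.mem_pi, Set.mem_prod, Finset.mem_coe, Set.mem_univ, and_true]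
      refine forall₂_congr fun j hj => ?_
      rw [Function.update_of_ne (ne_of_mem_of_not_mem hj his)]
    rw [this, Measure.prod_prod, Measure.infinitePi_pi _ fun j _ => hA j, measure_univ, mul_one]

lemma lintegral_infinitePi_update {ι E : Type*} [DecidableEq ι] [MeasurableSpace E]
    (μ : ι → Measure E) [∀ i, IsProbabilityMeasure (μ i)] (i : ι) {H : (ι → E) → ℝ≥0∞}
    (hH : Measurable H) :
    ∫⁻ x, H x ∂Measure.infinitePi μ =
      ∫⁻ x, ∫⁻ y, H (Function.update x i y) ∂μ i ∂Measure.infinitePi μ := by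
  conv_lhs => rw [← map_update_infinitePi μ i]
  rw [lintegral_map hH (measurable_update_prod i),
    lintegral_prod (fun p => H (Function.update p.1 i p.2))
      (hH.comp (measurable_update_prod i)).aemeasurable]

/-- The pairs formed from two independent families of independent variables are independent. -/
lemma iIndepFun_prodMk {Ω ι E F : Type*} [MeasurableSpace Ω] [MeasurableSpace E]
    [MeasurableSpace F] {P : Measure Ω} {X : ι → Ω → E} {Y : ι → Ω → F}
    (hX : ∀ i, Measurable (X i)) (hY : ∀ i, Measurable (Y i))
    (iX : iIndepFun X P) (iY : iIndepFun Y P)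
    (hXY : IndepFun (fun ω i => X i ω) (fun ω i => Y i ω) P) :
    iIndepFun (fun i ω => (X i ω, Y i ω)) P := by
  rw [iIndepFun_iff_iIndep]
  -- Preimages of rectangles form a π-system generating the σ-algebra of the pair, and on them the
  -- product formula splits into the three given independences.
  let π : ι → Set (Set Ω) := fun i =>
    {s | ∃ A B, MeasurableSet A ∧ MeasurableSet B ∧ s = X i ⁻¹' A ∩ Y i ⁻¹' B}
  refine iIndepSets.iIndep (π := π) (fun i => ((hX i).prodMk (hY i)).comap_le) ?_ ?_ ?_
  · rintro i _ ⟨A, B, hA, hB, rfl⟩ _ ⟨A', B', hA', hB', rfl⟩ -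
    exact ⟨A ∩ A', B ∩ B', hA.inter hA', hB.inter hB', by
      ext; simp only [Set.mem_inter_iff, Set.mem_preimage]; tauto⟩
  · intro i
    rw [← generateFrom_prod, MeasurableSpace.comap_generateFrom]
    congr 1
    ext s
    constructor
    · rintro ⟨_, ⟨A, hA, B, hB, rfl⟩, rfl⟩
      exact ⟨A, B, hA, hB, rfl⟩
    · rintro ⟨A, B, hA, hB, rfl⟩
      exact ⟨A ×ˢ B, ⟨A, hA, B, hB, rfl⟩, rfl⟩
  · rw [iIndepSets_iff]
    intro s f hf
    choose! A B hA hB hf using hf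
    have e : ⋂ i ∈ s, f i = (fun ω i => X i ω) ⁻¹' (Set.pi s A) ∩
        (fun ω i => Y i ω) ⁻¹' (Set.pi s B) := by
      ext ω
      simp only [Set.mem_iInter, Set.mem_inter_iff, Set.mem_preimage, Set.mem_pi, Finset.mem_coe]
      constructor
      · intro h
        exact ⟨fun i hi => by have := h i hi; rw [hf i hi] at this; exact this.1,
          fun i hi => by have := h i hi; rw [hf i hi] at this; exact this.2⟩
      · rintro ⟨h1, h2⟩ i hi
        rw [hf i hi]
        exact ⟨h1 i hi, h2 i hi⟩
    have e1 : (fun ω i => X i ω) ⁻¹' (Set.pi s A) = ⋂ i ∈ s, X i ⁻¹' A i := by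
      ext; simp [Set.mem_pi]
    have e2 : (fun ω i => Y i ω) ⁻¹' (Set.pi s B) = ⋂ i ∈ s, Y i ⁻¹' B i := by
      ext; simp [Set.mem_pi]
    rw [e, hXY.measure_inter_preimage_eq_mul _ _ (.pi s.countable_toSet hA)
      (.pi s.countable_toSet hB), e1, e2, iX.measure_inter_preimage_eq_mul s hA,
      iY.measure_inter_preimage_eq_mul s hB, ← Finset.prod_mul_distrib]
    refine Finset.prod_congr rfl fun i hi => ?_
    rw [hf i hi]
    exact (IndepFun.measure_inter_preimage_eq_mul (hXY.comp (measurable_pi_apply i)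
      (measurable_pi_apply i)) _ _ (hA i hi) (hB i hi)).symm

end Product

/-! ### A criterion for conditional independence -/

section Criterion

/-- If the joint probabilities of `Z ∈ D` and `V i ∈ A i` are integrals of products of functions of
`Z`, then the coordinates are independent under the conditional law of `V` given `Z`. -/
lemma ae_iIndepFun_condDistrib {Ω ι β : Type*} [MeasurableSpace Ω] [Countable ι]
    [MeasurableSpace β] (P : Measure Ω) [IsProbabilityMeasure P] {V : Ω → ι → ℝ} {Z : Ω → β}
    (hV : Measurable V) (hZ : Measurable Z) (φ : ι → Set ℝ → β → ℝ≥0∞)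
    (hφ : ∀ i A, MeasurableSet A → Measurable (φ i A))
    (h : ∀ (S : Finset ι) (A : ι → Set ℝ), (∀ i, MeasurableSet (A i)) → ∀ D, MeasurableSet D →
      P (Z ⁻¹' D ∩ V ⁻¹' (Set.pi S A)) = ∫⁻ ω in Z ⁻¹' D, ∏ i ∈ S, φ i (A i) (Z ω) ∂P) :
    ∀ᵐ z ∂(P.map Z), iIndepFun (fun (i : ι) (y : ι → ℝ) => y i) (condDistrib V Z P z) := by
  classical
  have : IsProbabilityMeasure (P.map Z) := Measure.isProbabilityMeasure_map hZ.aemeasurable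
  have box : ∀ (S : Finset ι) (A : ι → Set ℝ), (∀ i, MeasurableSet (A i)) →
      ∀ᵐ z ∂(P.map Z), condDistrib V Z P z (Set.pi S A) = ∏ i ∈ S, φ i (A i) z := by
    intro S A hA
    have hS : MeasurableSet (Set.pi (S : Set ι) A) := .pi S.countable_toSet fun j _ => hA j
    refine ae_eq_of_forall_setLIntegral_eq_of_sigmaFinite (Kernel.measurable_coe _ hS)
      (Finset.measurable_prod _ fun i _ => hφ i _ (hA i)) fun D hD _ => ?_
    rw [setLIntegral_map hD (Kernel.measurable_coe _ hS) hZ,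
      setLIntegral_map hD (Finset.measurable_prod _ fun i _ => hφ i _ (hA i)) hZ,
      setLIntegral_preimage_condDistrib hZ hV.aemeasurable hS hD, h S A hA D hD]
  have prod : ∀ (S : Finset ι) (A : ι → Set ℝ), (∀ i, MeasurableSet (A i)) →
      ∀ᵐ z ∂(P.map Z), condDistrib V Z P z (Set.pi S A) =
        ∏ i ∈ S, condDistrib V Z P z ((fun y => y i) ⁻¹' A i) := by
    intro S A hA
    -- One-element boxes identify `φ i (A i)` as the conditional marginal.
    have h1 : ∀ᵐ z ∂(P.map Z), ∀ i : ι, condDistrib V Z P z (Set.pi ({i} : Finset ι) A) =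
        ∏ j ∈ ({i} : Finset ι), φ j (A j) z := ae_all_iff.2 fun i => box {i} A hA
    filter_upwards [box S A hA, h1] with z hz h1
    rw [hz]
    refine Finset.prod_congr rfl fun i _ => ?_
    have := h1 i
    rw [Finset.prod_singleton] at this
    rw [← this]
    congr 1
    ext y; simp
  -- One null set must serve all boxes, so only the countably many boxes of rational half-lines are
  -- used; these half-lines still generate the Borel sets.
  have all : ∀ᵐ z ∂(P.map Z), ∀ (S : Finset ι) (q : S → ℚ), condDistrib V Z P z
      (Set.pi S fun i => if hi : i ∈ S then Set.Iio (q ⟨i, hi⟩ : ℝ) else Set.univ) =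
        ∏ i ∈ S, condDistrib V Z P z
          ((fun y => y i) ⁻¹' (if hi : i ∈ S then Set.Iio (q ⟨i, hi⟩ : ℝ) else Set.univ)) := by
    refine ae_all_iff.2 fun S => ae_all_iff.2 fun q => prod S _ fun i => ?_
    split_ifs
    exacts [measurableSet_Iio, .univ]
  filter_upwards [all] with z hz
  rw [iIndepFun_iff_iIndep]
  refine iIndepSets.iIndep
    (π := fun i => {s | ∃ q : ℚ, s = (fun y : ι → ℝ => y i) ⁻¹' Set.Iio (q : ℝ)})
    (fun i => (measurable_pi_apply i).comap_le) ?_ ?_ ?_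
  · rintro i _ ⟨q, rfl⟩ _ ⟨q', rfl⟩ -
    refine ⟨min q q', ?_⟩
    ext; simp
  · intro i
    have : Real.measurableSpace = borel ℝ := BorelSpace.measurable_eq
    rw [this, Real.borel_eq_generateFrom_Iio_rat, MeasurableSpace.comap_generateFrom]
    congr 1
    ext s
    simp only [Set.mem_image, Set.mem_iUnion, Set.mem_singleton_iff, Set.mem_ofPred_eq]
    constructor
    · rintro ⟨_, ⟨q, rfl⟩, rfl⟩
      exact ⟨q, rfl⟩
    · rintro ⟨q, rfl⟩
      exact ⟨_, ⟨q, rfl⟩, rfl⟩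
  · rw [iIndepSets_iff]
    intro S f hf
    choose! q hq using hf
    have := hz S (fun i => q i)
    convert this using 2
    · ext y
      simp only [Set.mem_iInter, Set.mem_pi, Finset.mem_coe]
      refine forall₂_congr fun i hi => ?_
      rw [hq i hi, dif_pos hi]
      rfl
    · rename_i i hi
      rw [hq i hi, dif_pos hi]

/-- Functions of disjoint blocks of conditionally independent variables are conditionally
independent. -/
lemma condIndepGiven_of_blocks {Ω κ : Type*} [MeasurableSpace Ω] [Countable κ]
    (P : Measure Ω) [IsProbabilityMeasure P] {V : Ω → ℕ × κ → ℝ} {Z : Ω → ℕ → ℝ}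
    (hV : Measurable V) (hZ : Measurable Z)
    (h : ∀ᵐ z ∂(P.map Z),
      iIndepFun (fun (i : ℕ × κ) (y : ℕ × κ → ℝ) => y i) (condDistrib V Z P z))
    (ψ : ℕ → (κ → ℝ) → ℝ) (hψ : ∀ k, Measurable (ψ k)) :
    CondIndepGiven P (fun ω k => ψ k fun j => V ω (k, j)) Z := by
  have hΨ : Measurable (fun (y : ℕ × κ → ℝ) (k : ℕ) => ψ k fun j => y (k, j)) :=
    measurable_pi_iff.2 fun k => (hψ k).comp (by fun_prop)
  refine ⟨(hΨ.comp hV).aemeasurable, hZ.aemeasurable, ?_⟩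
  filter_upwards [h, condDistrib_comp Z hV.aemeasurable hΨ] with z hz hc
  change condDistrib (fun ω k => ψ k fun j => V ω (k, j)) Z P z = _ at hc
  rw [hc, Kernel.map_apply _ hΨ]
  set μ := condDistrib V Z P z
  have hp : ∀ i, IsProbabilityMeasure (μ.map fun y => y i) := fun i =>
    Measure.isProbabilityMeasure_map (measurable_pi_apply i).aemeasurable
  -- Independence says that the conditional law is a product measure; currying turns it into a
  -- product over blocks, and `ψ k` acts on the k-th block alone.
  have hμ : μ = Measure.infinitePi fun i => μ.map fun y => y i := by
    have := (iIndepFun_iff_map_fun_eq_infinitePi_map (measurable_pi_apply ·)).1 hz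
    rwa [show (fun (ω : ℕ × κ → ℝ) i => ω i) = id from rfl, Measure.map_id] at this
  have hcur : μ.map (MeasurableEquiv.curry ℕ κ ℝ) =
      Measure.infinitePi fun k => Measure.infinitePi fun j => μ.map fun y => y (k, j) := by
    conv_lhs => rw [hμ]
    exact Measure.infinitePi_map_curry (fun k j => μ.map fun y => y (k, j))
  have hm : μ.map (fun (y : ℕ × κ → ℝ) (k : ℕ) => ψ k fun j => y (k, j)) =
      Measure.infinitePi fun k =>
        (Measure.infinitePi fun j => μ.map fun y => y (k, j)).map (ψ k) := by
    rw [← Measure.infinitePi_map_pi _ hψ, ← hcur, Measure.map_map (by fun_prop) (by fun_prop)]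
    rfl
  have hp' : ∀ k, IsProbabilityMeasure
      ((Measure.infinitePi fun j => μ.map fun y => y (k, j)).map (ψ k)) := fun k =>
    Measure.isProbabilityMeasure_map (hψ k).aemeasurable
  rw [hm]
  exact iIndepFun_infinitePi (X := fun _ x => x) fun _ => measurable_id

end Criterion

/-! ### Functionals of weighted trees -/

section Trees

/-- A weighted tree in Ulam–Harris coding: each vertex carries its number of children and the weight
of the edge to its parent. -/
abbrev WTree : Type := List ℕ → ℕ × ℝ≥0∞

/-- The tree of the descendants of the `i`-th child of the root. -/
def sub (i : ℕ) (t : WTree) : WTree := fun u => t (u ++ [i])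

/-- The tree of the descendants of `v`. -/
def shift (v : List ℕ) (t : WTree) : WTree := fun u => t (u ++ v)

/-- The least `p` for which there is a path of length `n` from the root with all weights `≤ p`. -/
noncomputable def level : ℕ → WTree → ℝ≥0∞
  | 0, _ => 0
  | n + 1, t => (Finset.range (t []).1).inf fun i => max (sub i t []).2 (level n (sub i t))

/-- The percolation threshold of the root. -/
noncomputable def thr (t : WTree) : ℝ≥0∞ := ⨆ n, level n t

/-- The percolation threshold of the parent of the root through the root. -/
noncomputable def gate (t : WTree) : ℝ≥0∞ := max (t []).2 (thr t)

/-- `i` is the unique child of the root through which the threshold of the root is attained. -/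
def IsBest (t : WTree) (i : ℕ) : Prop :=
  i < (t []).1 ∧ ∀ j < (t []).1, j ≠ i → gate (sub i t) < gate (sub j t)

/-- The child of the root through which the threshold is attained. -/
noncomputable def best (t : WTree) : ℕ := sInf {i | IsBest t i}

/-- The tree of the descendants of the best child. -/
noncomputable def next (t : WTree) : WTree := sub (best t) t

/-- All the edges from the parent of the root to `s` are present and have weight at most `z`. -/
def Conn (z : ℝ≥0∞) (t : WTree) : List ℕ → Prop
  | [] => (t []).2 ≤ z
  | i :: s => Conn z t s ∧ i < (t s).1 ∧ (t (i :: s)).2 ≤ z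

open Classical in
/-- The weight of the cluster at level `z` of the parent of the root inside the tree. -/
noncomputable def clusterWeight (z : ℝ≥0∞) (t : WTree) : ℝ≥0∞ :=
  ∑' s, if Conn z t s then (t s).2 else 0

/-- The weight of the clusters at level `z` hanging off a vertex with `x` children and subtrees `ξ`,
the `i`-th child excepted. -/
noncomputable def hangingWeight (z : ℝ≥0∞) (i x : ℕ) (ξ : ℕ → WTree) : ℝ≥0∞ :=
  ∑ j ∈ Finset.range x, if j = i then 0 else clusterWeight z (ξ j)

/-- The weight of the forest hanging off the root, without the best child. -/
noncomputable def forest (t : WTree) : ℝ≥0∞ :=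
  hangingWeight (thr t) (best t) (t []).1 fun j => sub j t

-- Thresholds, gates and best children

lemma level_mono (n : ℕ) : ∀ t, level n t ≤ level (n + 1) t := by
  induction n with
  | zero => intro t; exact zero_le
  | succ n ih =>
    intro t
    exact Finset.inf_mono_fun fun i _ => max_le_max le_rfl (ih _)

lemma level_monotone (t : WTree) : Monotone fun n => level n t :=
  monotone_nat_of_le_succ fun n => level_mono n t

/-- A minimum over finitely many children commutes with the supremum of the increasing levels. This
is the compactness that makes the threshold, a limit over finite paths, satisfy an exact recursion.
-/
lemma thr_eq_inf (t : WTree) :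
    thr t = (Finset.range (t []).1).inf fun i => gate (sub i t) := by
  apply le_antisymm
  · refine iSup_le fun n => (level_mono n t).trans ?_
    exact Finset.inf_mono_fun fun i _ => max_le_max le_rfl (le_iSup (fun n => level n (sub i t)) n)
  · refine le_of_forall_lt fun b hb => ?_
    have hb' : b < ⊤ := hb.trans_le le_top
    rw [Finset.lt_inf_iff hb'] at hb
    have : ∀ i ∈ Finset.range (t []).1, ∃ n, b < max (sub i t []).2 (level n (sub i t)) := by
      intro i hi
      rcases lt_max_iff.1 (hb i hi) with h | h
      · exact ⟨0, lt_max_of_lt_left h⟩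
      · obtain ⟨n, hn⟩ := lt_iSup_iff.1 h
        exact ⟨n, lt_max_of_lt_right hn⟩
    choose! n hn using this
    -- There are finitely many children, so the largest of their depths works for all of them.
    have h2 : b < level ((Finset.range (t []).1).sup n + 1) t := by
      rw [level, Finset.lt_inf_iff hb']
      intro i hi
      exact (hn i hi).trans_le
        (max_le_max le_rfl (level_monotone _ (Finset.le_sup (f := n) hi)))
    exact h2.trans_le (le_iSup (fun n => level n t) _)

lemma thr_le_gate {t : WTree} {i : ℕ} (hi : i < (t []).1) : thr t ≤ gate (sub i t) := by
  rw [thr_eq_inf]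
  exact Finset.inf_le (Finset.mem_range.2 hi)

lemma IsBest.thr_eq {t : WTree} {i : ℕ} (h : IsBest t i) : thr t = gate (sub i t) := by
  refine le_antisymm (thr_le_gate h.1) ?_
  rw [thr_eq_inf]
  refine Finset.le_inf fun j hj => ?_
  by_cases hji : j = i
  · rw [hji]
  · exact (h.2 j (Finset.mem_range.1 hj) hji).le

lemma IsBest.unique {t : WTree} {i j : ℕ} (hi : IsBest t i) (hj : IsBest t j) : i = j := by
  by_contra h
  exact lt_asymm (hi.2 j hj.1 (Ne.symm h)) (hj.2 i hi.1 h)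

lemma IsBest.best_eq {t : WTree} {i : ℕ} (h : IsBest t i) : best t = i :=
  (Nat.sInf_mem (s := {i | IsBest t i}) ⟨i, h⟩ : IsBest t (best t)).unique h

/-- The second alternative is the default `sInf ∅ = 0`; it is needed for measurability of `best` on
all trees. -/
lemma best_eq_iff (t : WTree) (i : ℕ) :
    best t = i ↔ IsBest t i ∨ (i = 0 ∧ ∀ j, ¬ IsBest t j) := by
  constructor
  · rintro rfl
    by_cases h : ∃ j, IsBest t j
    · exact .inl (Nat.sInf_mem h)
    · push Not at h
      refine .inr ⟨?_, h⟩
      rw [best, show {i | IsBest t i} = ∅ from Set.eq_empty_of_forall_notMem h, Nat.sInf_empty]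
  · rintro (h | ⟨rfl, h⟩)
    · exact h.best_eq
    · rw [best, show {i | IsBest t i} = ∅ from Set.eq_empty_of_forall_notMem h, Nat.sInf_empty]

-- Measurability of the tree functionals

@[fun_prop]
lemma measurable_sub (i : ℕ) : Measurable (sub i) :=
  measurable_pi_iff.2 fun u => measurable_pi_apply (u ++ [i])

@[fun_prop]
lemma measurable_offspring : Measurable fun t : WTree => (t []).1 := by fun_prop

lemma measurable_inf_range {α : Type*} [MeasurableSpace α] {x : α → ℕ} (hx : Measurable x)
    {f : ℕ → α → ℝ≥0∞} (hf : ∀ i, Measurable (f i)) :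
    Measurable fun a => (Finset.range (x a)).inf fun i => f i a := by
  have : Measurable fun p : ℕ × α => (Finset.range p.1).inf fun i => f i p.2 := by
    refine measurable_from_prod_countable_right fun n => ?_
    change Measurable fun a => (Finset.range n).inf fun i => f i a
    induction n with
    | zero => simp
    | succ n ih =>
      simp only [Finset.range_add_one, Finset.inf_insert]
      exact (hf n).inf ih
  exact this.comp (hx.prodMk measurable_id)

@[fun_prop]
lemma measurable_level (n : ℕ) : Measurable (level n) := by
  induction n with
  | zero => exact measurable_const
  | succ n ih =>
    exact measurable_inf_range measurable_offspring fun i => by fun_prop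

@[fun_prop]
lemma measurable_thr : Measurable thr := Measurable.iSup measurable_level

@[fun_prop]
lemma measurable_gate : Measurable gate := by unfold gate; fun_prop

lemma measurableSet_isBest (i : ℕ) : MeasurableSet {t | IsBest t i} := by
  have : {t | IsBest t i} = {t : WTree | i < (t []).1} ∩ ⋂ j, ({t | ¬ j < (t []).1} ∪
      {t | j = i} ∪ {t | gate (sub i t) < gate (sub j t)}) := by
    ext t
    simp only [IsBest, Set.mem_ofPred_eq, Set.mem_inter_iff, Set.mem_iInter, Set.mem_union]
    refine and_congr_right fun _ => forall_congr' fun j => ?_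
    tauto
  rw [this]
  refine (measurableSet_lt measurable_const measurable_offspring).inter
    (MeasurableSet.iInter fun j => ((MeasurableSet.compl ?_).union (.const _)).union ?_)
  · exact measurableSet_lt measurable_const measurable_offspring
  · exact measurableSet_lt (by fun_prop) (by fun_prop)

@[fun_prop]
lemma measurable_best : Measurable best := by
  refine measurable_to_countable' fun i => ?_
  have : best ⁻¹' {i} = {t | IsBest t i} ∪ ({_t | i = 0} ∩ ⋂ j, {t | IsBest t j}ᶜ) := by
    ext t
    simp only [Set.mem_preimage, Set.mem_singleton_iff, best_eq_iff, Set.mem_union,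
      Set.mem_inter_iff, Set.mem_ofPred_eq, Set.mem_iInter, Set.mem_compl_iff]
  rw [this]
  exact (measurableSet_isBest i).union
    ((MeasurableSet.const _).inter (.iInter fun j => (measurableSet_isBest j).compl))

@[fun_prop]
lemma measurable_next : Measurable next := by
  have : Measurable fun p : ℕ × WTree => sub p.1 p.2 :=
    measurable_from_prod_countable_right fun n => measurable_sub n
  exact this.comp (measurable_best.prodMk measurable_id)

lemma measurableSet_conn (s : List ℕ) : MeasurableSet {p : ℝ≥0∞ × WTree | Conn p.1 p.2 s} := by
  induction s with
  | nil =>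
    change MeasurableSet {p : ℝ≥0∞ × WTree | (p.2 []).2 ≤ p.1}
    exact measurableSet_le (by fun_prop) measurable_fst
  | cons i s ih =>
    refine ih.inter ((?_ : MeasurableSet {p : ℝ≥0∞ × WTree | i < (p.2 s).1}).inter
      (?_ : MeasurableSet {p : ℝ≥0∞ × WTree | (p.2 (i :: s)).2 ≤ p.1}))
    · exact measurableSet_lt measurable_const (by fun_prop)
    · exact measurableSet_le (by fun_prop) measurable_fst

lemma measurable_clusterWeight :
    Measurable fun p : ℝ≥0∞ × WTree => clusterWeight p.1 p.2 := by
  classical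
  unfold clusterWeight
  refine Measurable.tsum fun s => ?_
  exact Measurable.ite (measurableSet_conn s) (by fun_prop) measurable_const

lemma measurable_hangingWeight :
    Measurable fun p : ((ℝ≥0∞ × ℕ) × ℕ) × (ℕ → WTree) =>
      hangingWeight p.1.1.1 p.1.1.2 p.1.2 p.2 := by
  have : ∀ i x : ℕ, Measurable fun p : ℝ≥0∞ × (ℕ → WTree) => hangingWeight p.1 i x p.2 := by
    intro i x
    refine Finset.measurable_sum _ fun j _ => ?_
    split_ifs
    · exact measurable_const
    · exact measurable_clusterWeight.comp
        (f := fun p : ℝ≥0∞ × (ℕ → WTree) => (p.1, p.2 j)) (by fun_prop)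
  have h : Measurable fun q : (ℕ × ℕ) × (ℝ≥0∞ × (ℕ → WTree)) =>
      hangingWeight q.2.1 q.1.1 q.1.2 q.2.2 :=
    measurable_from_prod_countable_right fun n => this n.1 n.2
  exact h.comp (g := fun q : (ℕ × ℕ) × (ℝ≥0∞ × (ℕ → WTree)) =>
    hangingWeight q.2.1 q.1.1 q.1.2 q.2.2)
    (f := fun p : ((ℝ≥0∞ × ℕ) × ℕ) × (ℕ → WTree) => ((p.1.1.2, p.1.2), (p.1.1.1, p.2)))
    (by fun_prop)

@[fun_prop]
lemma measurable_forest : Measurable forest :=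
  measurable_hangingWeight.comp (f := fun t : WTree =>
    (((thr t, best t), (t []).1), fun j => sub j t)) (by fun_prop)

end Trees

/-! ### The law of a branching process tree -/

section Law

/-- The law of the tree with i.i.d. vertex data. -/
noncomputable def treeLaw (η : Measure (ℕ × ℝ≥0∞)) : Measure WTree :=
  Measure.infinitePi fun _ : List ℕ => η

variable (η : Measure (ℕ × ℝ≥0∞)) [IsProbabilityMeasure η]

instance : IsProbabilityMeasure (treeLaw η) := by unfold treeLaw; infer_instance

@[fun_prop]
lemma measurable_shift (v : List ℕ) : Measurable (shift v) :=
  measurable_pi_iff.2 fun u => measurable_pi_apply (u ++ v)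

/-- Appending `v` is injective on vertices, so the shifted tree reads distinct i.i.d. coordinates.
It carries almost sure properties of the root to every vertex. -/
lemma measurePreserving_shift (v : List ℕ) :
    MeasurePreserving (shift v) (treeLaw η) (treeLaw η) where
  measurable := measurable_shift v
  map_eq := Measure.map_infinitePi_infinitePi_of_inj (f := fun u : List ℕ => u ++ v)
    (P := fun _ => η) fun _ _ h => List.append_cancel_right h

/-- The root and the subtrees of the children of the root are independent. -/
lemma map_root_subtrees :
    (treeLaw η).map (fun t => (t [], fun i => sub i t)) =
      η.prod (Measure.infinitePi fun _ : ℕ => treeLaw η) := by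
  have hind : iIndepFun (fun (v : List ℕ) (t : WTree) => t v) (treeLaw η) :=
    iIndepFun_infinitePi (X := fun _ x => x) fun _ => measurable_id
  have h := indepFun_of_disjoint_range hind (fun v => measurable_pi_apply v)
    (fun _ : Unit => ([] : List ℕ)) (fun p : ℕ × List ℕ => p.2 ++ [p.1]) (by
      rw [Set.disjoint_left]
      rintro _ ⟨_, rfl⟩ ⟨p, hp⟩
      simp at hp)
  have h' : IndepFun (fun t : WTree => t []) (fun (t : WTree) i => sub i t) (treeLaw η) := by
    have hm : Measurable fun (y : ℕ × List ℕ → ℕ × ℝ≥0∞) (i : ℕ) (u : List ℕ) => y (i, u) := by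
      fun_prop
    exact h.comp (measurable_pi_apply ()) hm
  rw [(indepFun_iff_map_prod_eq_prod_map_map (Measurable.aemeasurable (by fun_prop))
    (Measurable.aemeasurable (by fun_prop))).1 h']
  congr 1
  · exact Measure.infinitePi_map_eval (fun _ : List ℕ => η) []
  · have e : (fun (t : WTree) i => sub i t) = (MeasurableEquiv.curry ℕ (List ℕ) (ℕ × ℝ≥0∞)) ∘
        (fun (t : WTree) (p : ℕ × List ℕ) => t (p.2 ++ [p.1])) := rfl
    -- Different children own disjoint sets of coordinates, so the subtrees are i.i.d. copies of the
    -- tree.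
    have hinj : Function.Injective fun p : ℕ × List ℕ => p.2 ++ [p.1] := by
      rintro ⟨i, u⟩ ⟨j, v⟩ h
      have := List.append_inj' h rfl
      simp_all
    rw [e, ← Measure.map_map (by fun_prop) (by fun_prop), treeLaw,
      Measure.map_infinitePi_infinitePi_of_inj (P := fun _ => η) hinj]
    exact Measure.infinitePi_map_curry (fun (_ : ℕ) (_ : List ℕ) => η)

lemma lintegral_root_subtrees {H : (ℕ × ℝ≥0∞) × (ℕ → WTree) → ℝ≥0∞} (hH : Measurable H) :
    ∫⁻ t, H (t [], fun i => sub i t) ∂treeLaw η =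
      ∫⁻ p, H p ∂η.prod (Measure.infinitePi fun _ : ℕ => treeLaw η) := by
  rw [← map_root_subtrees, lintegral_map hH (by fun_prop)]

/-- Distinct subtrees are independent. -/
lemma map_sub_prod {i j : ℕ} (hij : i ≠ j) :
    (treeLaw η).map (fun t => (sub i t, sub j t)) = (treeLaw η).prod (treeLaw η) := by
  have : (fun t => (sub i t, sub j t)) =
      (fun p : (ℕ × ℝ≥0∞) × (ℕ → WTree) => (p.2 i, p.2 j)) ∘
        fun t : WTree => (t [], fun i => sub i t) := rfl
  rw [this, ← Measure.map_map (by fun_prop) (by fun_prop), map_root_subtrees]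
  have e : (fun p : (ℕ × ℝ≥0∞) × (ℕ → WTree) => (p.2 i, p.2 j)) =
      (fun x : ℕ → WTree => (x i, x j)) ∘ Prod.snd := rfl
  rw [e, ← Measure.map_map (by fun_prop) (by fun_prop), ← Measure.snd, Measure.snd_prod]
  exact Measure.infinitePi_map_eval_prod (P := fun _ : ℕ => treeLaw η) hij

/-- A functional without atoms of a subtree differs almost surely from any functional of another
subtree. -/
lemma ae_ne_of_noAtoms {i j : ℕ} (hij : i ≠ j) {f g : WTree → ℝ≥0∞} (hf : Measurable f)
    (hg : Measurable g) (h : ∀ z, treeLaw η {t | f t = z} = 0) :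
    ∀ᵐ t ∂treeLaw η, f (sub i t) ≠ g (sub j t) := by
  have hs : MeasurableSet {p : WTree × WTree | f p.2 = g p.1} :=
    measurableSet_eq_fun (hf.comp measurable_snd) (hg.comp measurable_fst)
  have h0 : ((treeLaw η).prod (treeLaw η)) {p : WTree × WTree | f p.2 = g p.1} = 0 := by
    rw [Measure.prod_apply hs]
    exact (lintegral_congr fun t => h (g t)).trans lintegral_zero
  rw [← map_sub_prod η hij.symm, Measure.map_apply (by fun_prop) hs] at h0
  exact measure_eq_zero_iff_ae_notMem.1 h0

/-- The tree with the weight of the root replaced. -/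
def setRoot (t : WTree) (u : ℝ≥0∞) : WTree := Function.update t [] ((t []).1, u)

/-- The weight stored at the root belongs to the edge above it, so nothing below sees it. Of the
functionals treated here, only `gate` changes, to `max u (thr t)`. -/
lemma sub_setRoot (i : ℕ) (t : WTree) (u : ℝ≥0∞) : sub i (setRoot t u) = sub i t := by
  funext s
  exact Function.update_of_ne (by simp) _ _

@[simp] lemma setRoot_nil (t : WTree) (u : ℝ≥0∞) : setRoot t u [] = ((t []).1, u) :=
  Function.update_self _ _ _

lemma level_setRoot (n : ℕ) (t : WTree) (u : ℝ≥0∞) : level n (setRoot t u) = level n t := by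
  cases n with
  | zero => rfl
  | succ n => simp only [level, sub_setRoot, setRoot_nil]

lemma thr_setRoot (t : WTree) (u : ℝ≥0∞) : thr (setRoot t u) = thr t := by
  simp only [thr, level_setRoot]

lemma gate_setRoot (t : WTree) (u : ℝ≥0∞) : gate (setRoot t u) = max u (thr t) := by
  rw [gate, thr_setRoot, setRoot_nil]

lemma best_setRoot (t : WTree) (u : ℝ≥0∞) : best (setRoot t u) = best t := by
  simp only [best, IsBest, sub_setRoot, setRoot_nil]

lemma next_setRoot (t : WTree) (u : ℝ≥0∞) : next (setRoot t u) = next t := by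
  rw [next, best_setRoot, sub_setRoot, next]

lemma forest_setRoot (t : WTree) (u : ℝ≥0∞) : forest (setRoot t u) = forest t := by
  simp only [forest, thr_setRoot, best_setRoot, sub_setRoot, setRoot_nil]

lemma measurable_setRoot : Measurable fun p : WTree × ℝ≥0∞ => setRoot p.1 p.2 :=
  (measurable_update_prod []).comp
    (f := fun p : WTree × ℝ≥0∞ => (p.1, ((p.1 []).1, p.2))) (by fun_prop)

/-- The weight of the root can be resampled independently. -/
lemma lintegral_setRoot (ν : Measure ℕ) (lam : Measure ℝ≥0∞) [IsProbabilityMeasure ν]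
    [IsProbabilityMeasure lam] {H : WTree → ℝ≥0∞} (hH : Measurable H) :
    ∫⁻ t, H t ∂treeLaw (ν.prod lam) =
      ∫⁻ t, ∫⁻ u, H (setRoot t u) ∂lam ∂treeLaw (ν.prod lam) := by
  have hH' : Measurable fun p : WTree × ℝ≥0∞ => H (setRoot p.1 p.2) := hH.comp measurable_setRoot
  -- Once the whole root datum has been resampled, resampling its weight a second time does not
  -- change the integral.
  have h1 : ∀ t : WTree, ∫⁻ e, H (Function.update t [] e) ∂ν.prod lam =
      ∫⁻ e, ∫⁻ u, H (setRoot (Function.update t [] e) u) ∂lam ∂ν.prod lam := by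
    intro t
    have hu : Measurable fun e : ℕ × ℝ≥0∞ => H (Function.update t [] e) :=
      hH.comp (measurable_update t)
    rw [lintegral_prod _ hu.aemeasurable]
    have e1 : ∀ e : ℕ × ℝ≥0∞, ∀ u, setRoot (Function.update t [] e) u =
        Function.update t [] (e.1, u) := by
      intro e u; simp [setRoot]
    simp only [e1]
    have hm : Measurable fun x : ℕ => ∫⁻ u, H (Function.update t [] (x, u)) ∂lam :=
      measurable_of_countable _
    have := lintegral_map hm (measurable_fst (α := ℕ) (β := ℝ≥0∞)) (μ := ν.prod lam)
    rw [← this, ← Measure.fst, Measure.fst_prod]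
  rw [treeLaw, lintegral_infinitePi_update _ [] hH,
    lintegral_infinitePi_update _ [] hH'.lintegral_prod_right']
  exact lintegral_congr h1

end Law

/-! ### The percolation threshold has no atoms -/

section Threshold

set_option linter.unusedSectionVars false

/-- The uniform distribution on `[0, 1]`, as a measure on the extended non-negative reals. -/
noncomputable def unifLaw : Measure ℝ≥0∞ :=
  (volume.restrict (Set.Icc (0 : ℝ) 1)).map ENNReal.ofReal

instance : IsProbabilityMeasure unifLaw := by
  have : IsProbabilityMeasure (volume.restrict (Set.Icc (0 : ℝ) 1)) := ⟨by simp⟩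
  exact Measure.isProbabilityMeasure_map ENNReal.measurable_ofReal.aemeasurable

lemma unifLaw_singleton (z : ℝ≥0∞) : unifLaw {z} = 0 := by
  rw [unifLaw, Measure.map_apply ENNReal.measurable_ofReal (measurableSet_singleton z),
    Measure.restrict_apply (ENNReal.measurable_ofReal (measurableSet_singleton z))]
  refine measure_mono_null (t := {z.toReal}) ?_ (by simp)
  rintro x ⟨hx, h0, -⟩
  rw [Set.mem_preimage, Set.mem_singleton_iff] at hx
  rw [Set.mem_singleton_iff, ← hx, ENNReal.toReal_ofReal h0]

lemma unifLaw_Iic {p : ℝ} (h0 : 0 ≤ p) (h1 : p ≤ 1) :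
    unifLaw (Set.Iic (ENNReal.ofReal p)) = ENNReal.ofReal p := by
  rw [unifLaw, Measure.map_apply ENNReal.measurable_ofReal measurableSet_Iic,
    Measure.restrict_apply (ENNReal.measurable_ofReal measurableSet_Iic)]
  have : ENNReal.ofReal ⁻¹' Set.Iic (ENNReal.ofReal p) ∩ Set.Icc 0 1 = Set.Icc 0 p := by
    ext x
    simp only [Set.mem_inter_iff, Set.mem_preimage, Set.mem_Iic, Set.mem_Icc,
      ENNReal.ofReal_le_ofReal_iff h0]
    constructor
    · rintro ⟨h, h', -⟩; exact ⟨h', h⟩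
    · rintro ⟨h, h'⟩; exact ⟨h', h, h'.trans h1⟩
  rw [this]; simp

lemma ae_unifLaw_le_one : ∀ᵐ u ∂unifLaw, u ≤ 1 := by
  rw [unifLaw, ae_map_iff ENNReal.measurable_ofReal.aemeasurable measurableSet_Iic]
  filter_upwards [ae_restrict_mem measurableSet_Icc] with x hx
  exact ENNReal.ofReal_le_one.2 hx.2

/-- The probability that at least one of the children of a vertex is selected, when each is selected
independently with probability `s`. -/
noncomputable def hitProb (ν : Measure ℕ) (s : ℝ) : ℝ := 1 - ∫ x, (1 - s) ^ x ∂ν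

variable (ν : Measure ℕ) [IsProbabilityMeasure ν]

lemma integrable_one_sub_pow {s : ℝ} (h0 : 0 ≤ s) (h1 : s ≤ 1) :
    Integrable (fun x : ℕ => (1 - s) ^ x) ν := by
  refine Integrable.of_bound (measurable_of_countable _).aestronglyMeasurable 1 (ae_of_all _ ?_)
  intro x
  rw [Real.norm_of_nonneg (pow_nonneg (by linarith) _)]
  exact pow_le_one₀ (by linarith) (by linarith)

lemma continuousOn_hitProb : ContinuousOn (hitProb ν) (Set.Icc 0 1) := by
  refine continuousOn_const.sub (continuousOn_of_dominated (bound := fun _ => 1) ?_ ?_ ?_ ?_)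
  · exact fun s _ => (measurable_of_countable _).aestronglyMeasurable
  · intro s hs
    refine ae_of_all _ fun x => ?_
    rw [Real.norm_of_nonneg (pow_nonneg (by linarith [hs.2]) _)]
    exact pow_le_one₀ (by linarith [hs.2]) (by linarith [hs.1])
  · exact integrable_const _
  · exact ae_of_all _ fun x => by fun_prop

lemma hitProb_mono {s t : ℝ} (h0 : 0 ≤ s) (hst : s ≤ t) (h1 : t ≤ 1) :
    hitProb ν s ≤ hitProb ν t := by
  refine sub_le_sub_left (integral_mono (integrable_one_sub_pow ν (h0.trans hst) h1)
    (integrable_one_sub_pow ν h0 (hst.trans h1)) fun x => ?_) _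
  exact pow_le_pow_left₀ (by linarith) (by linarith) _

/-- Strict concavity of `hitProb` between `0` and `s`. -/
lemma mul_hitProb_lt (hν : ν {x | 2 ≤ x} ≠ 0) {s l : ℝ} (hs0 : 0 < s) (hs1 : s ≤ 1) (hl0 : 0 < l)
    (hl1 : l < 1) : l * hitProb ν s < hitProb ν (l * s) := by
  have hls0 : 0 ≤ l * s := by positivity
  have hls1 : l * s ≤ 1 := by nlinarith
  have i1 := integrable_one_sub_pow ν hs0.le hs1
  have i2 := integrable_one_sub_pow ν hls0 hls1
  have e : ∀ x : ℕ, 1 - l * s = l • (1 - s) + (1 - l) • (1 : ℝ) := fun _ => by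
    simp only [smul_eq_mul]; ring
  -- The convexity gap of `(1 - s) ^ x` between `0` and `s`: it vanishes for `x ≤ 1` and is positive
  -- for `x ≥ 2`, so its mean is positive because `ν` charges `{x | 2 ≤ x}`.
  let D : ℕ → ℝ := fun x => l * (1 - s) ^ x + (1 - l) - (1 - l * s) ^ x
  have hD2 : ∀ x, 2 ≤ x → 0 < D x := by
    intro x hx
    have hsc : ∀ ⦃a : ℝ⦄, a ∈ Set.Ici 0 → ∀ ⦃b : ℝ⦄, b ∈ Set.Ici 0 → a ≠ b → ∀ ⦃k m : ℝ⦄,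
        0 < k → 0 < m → k + m = 1 → (k • a + m • b) ^ x < k • a ^ x + m • b ^ x :=
      fun _ ha _ hb => (strictConvexOn_pow hx).2 ha hb
    have := hsc (a := 1 - s) (b := 1) (by simp; linarith)
      (by simp) (by linarith) hl0 (m := 1 - l) (by linarith) (by ring)
    rw [← e x] at this
    simp only [smul_eq_mul, one_pow, mul_one] at this
    simp only [D]; linarith
  have hD : ∀ x, 0 ≤ D x := by
    intro x
    rcases lt_or_ge x 2 with h | h
    · interval_cases x <;> simp only [D, pow_zero, pow_one] <;> nlinarith
    · exact (hD2 x h).le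
  have iD : Integrable D ν := ((i1.const_mul l).add (integrable_const _)).sub i2
  have hpos : 0 < ∫ x, D x ∂ν := by
    rw [integral_pos_iff_support_of_nonneg hD iD]
    refine lt_of_lt_of_le (pos_iff_ne_zero.2 hν) (measure_mono fun x hx => ?_)
    exact (hD2 x hx).ne'
  have : ∫ x, D x ∂ν = l * ∫ x, (1 - s) ^ x ∂ν + (1 - l) - ∫ x, (1 - l * s) ^ x ∂ν := by
    simp only [D]
    have i3 : Integrable (fun x : ℕ => l * (1 - s) ^ x + (1 - l)) ν :=
      (i1.const_mul l).add (integrable_const _)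
    rw [integral_sub i3 i2, integral_add (i1.const_mul l) (integrable_const _), integral_const_mul]
    simp
  rw [this] at hpos
  simp only [hitProb]
  linarith

/-- The law of the branching process tree with uniform weights. -/
noncomputable abbrev bpLaw (ν : Measure ℕ) : Measure WTree := treeLaw (ν.prod unifLaw)

/-- The probability of a path of length `n` from the root with weights at most `p`. -/
noncomputable def pathProb (n : ℕ) (p : ℝ) : ℝ :=
  (bpLaw ν).real {t | level n t ≤ ENNReal.ofReal p}

/-- The uniform weight of the root is independent of the levels, so resampling it factorises the
probability. -/
lemma measure_root_level {n : ℕ} {p : ℝ} (h0 : 0 ≤ p) (h1 : p ≤ 1) :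
    bpLaw ν {t | max (t []).2 (level n t) ≤ ENNReal.ofReal p} =
      ENNReal.ofReal (p * pathProb ν n p) := by
  have hm : MeasurableSet {t | max (t []).2 (level n t) ≤ ENNReal.ofReal p} :=
    measurableSet_le (by fun_prop) measurable_const
  have hl : MeasurableSet {t | level n t ≤ ENNReal.ofReal p} :=
    measurableSet_le (by fun_prop) measurable_const
  rw [← lintegral_indicator_one hm, lintegral_setRoot ν unifLaw (measurable_one.indicator hm)]
  have : ∀ t : WTree, ∀ u : ℝ≥0∞,
      Set.indicator {t | max (t []).2 (level n t) ≤ ENNReal.ofReal p} (1 : WTree → ℝ≥0∞)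
        (setRoot t u) = Set.indicator {t | level n t ≤ ENNReal.ofReal p} (1 : WTree → ℝ≥0∞) t *
          (Set.Iic (ENNReal.ofReal p)).indicator 1 u := by
    intro t u
    simp only [Set.indicator_apply, Set.mem_ofPred_eq, setRoot_nil, level_setRoot, max_le_iff,
      Set.mem_Iic, Pi.one_apply]
    split_ifs <;> simp_all
  simp only [this]
  rw [lintegral_congr fun t => lintegral_const_mul _ (measurable_one.indicator measurableSet_Iic),
    lintegral_mul_const _ (measurable_one.indicator hl), lintegral_indicator_one hl,
    lintegral_indicator_one measurableSet_Iic, unifLaw_Iic h0 h1, ENNReal.ofReal_mul h0, mul_comm,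
    pathProb, ofReal_measureReal]

lemma pathProb_nonneg (n : ℕ) (p : ℝ) : 0 ≤ pathProb ν n p := measureReal_nonneg

lemma pathProb_le_one (n : ℕ) (p : ℝ) : pathProb ν n p ≤ 1 := measureReal_le_one

lemma pathProb_zero (p : ℝ) : pathProb ν 0 p = 1 := by
  simp [pathProb, level]

/-- There is no path of length `n + 1` exactly when every child fails; given the offspring number
the children fail independently, each with probability `1 - p * pathProb ν n p`. -/
lemma pathProb_succ (n : ℕ) {p : ℝ} (h0 : 0 ≤ p) (h1 : p ≤ 1) :
    pathProb ν (n + 1) p = hitProb ν (p * pathProb ν n p) := by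
  have hr0 := pathProb_nonneg ν n p
  have hr1 := pathProb_le_one ν n p
  have hl : MeasurableSet {t | level (n + 1) t ≤ ENNReal.ofReal p} :=
    measurableSet_le (by fun_prop) measurable_const
  set A : Set WTree := {t | max (t []).2 (level n t) ≤ ENNReal.ofReal p} with hA
  have hAm : MeasurableSet A := measurableSet_le (by fun_prop) measurable_const
  have hAc : (bpLaw ν) Aᶜ = ENNReal.ofReal (1 - p * pathProb ν n p) := by
    rw [prob_compl_eq_one_sub hAm, hA, measure_root_level ν h0 h1, ENNReal.ofReal_sub _
      (by positivity), ENNReal.ofReal_one]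
  have hc : {t | level (n + 1) t ≤ ENNReal.ofReal p}ᶜ =
      (fun t : WTree => (t [], fun i => sub i t)) ⁻¹'
        {q | ∀ j ∈ Finset.range q.1.1, q.2 j ∈ Aᶜ} := by
    ext t
    simp only [Set.mem_compl_iff, Set.mem_ofPred_eq, Set.mem_preimage, not_le, level, A]
    rw [Finset.lt_inf_iff ENNReal.ofReal_lt_top]
  have hSm : MeasurableSet
      {q : (ℕ × ℝ≥0∞) × (ℕ → WTree) | ∀ j ∈ Finset.range q.1.1, q.2 j ∈ Aᶜ} := by
    have : {q : (ℕ × ℝ≥0∞) × (ℕ → WTree) | ∀ j ∈ Finset.range q.1.1, q.2 j ∈ Aᶜ} =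
        ⋂ j, ({q | j < q.1.1}ᶜ ∪ {q | q.2 j ∈ Aᶜ}) := by
      ext q
      simp only [Set.mem_ofPred_eq, Finset.mem_range, Set.mem_iInter, Set.mem_union,
        Set.mem_compl_iff]
      exact forall_congr' fun j => by tauto
    rw [this]
    refine .iInter fun j => (MeasurableSet.compl ?_).union ?_
    · exact measurableSet_lt measurable_const (by fun_prop)
    · exact (show Measurable fun q : (ℕ × ℝ≥0∞) × (ℕ → WTree) => q.2 j by fun_prop) hAm.compl
  have key : bpLaw ν {t | level (n + 1) t ≤ ENNReal.ofReal p}ᶜ =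
      ∫⁻ x, ENNReal.ofReal (1 - p * pathProb ν n p) ^ x ∂ν := by
    rw [hc, ← Measure.map_apply (by fun_prop) hSm, map_root_subtrees, Measure.prod_apply hSm]
    have : ∀ e : ℕ × ℝ≥0∞, (Measure.infinitePi fun _ : ℕ => bpLaw ν)
        (Prod.mk e ⁻¹' {q | ∀ j ∈ Finset.range q.1.1, q.2 j ∈ Aᶜ}) =
          ENNReal.ofReal (1 - p * pathProb ν n p) ^ e.1 := by
      intro e
      have := Measure.infinitePi_pi (fun _ : ℕ => bpLaw ν) (s := Finset.range e.1)
        (t := fun _ => Aᶜ) fun _ _ => hAm.compl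
      rw [Finset.prod_const, Finset.card_range, hAc] at this
      rw [← this]
      rfl
    rw [lintegral_congr this]
    have hm : Measurable fun x : ℕ => ENNReal.ofReal (1 - p * pathProb ν n p) ^ x :=
      measurable_of_countable _
    have := lintegral_map hm (measurable_fst (α := ℕ) (β := ℝ≥0∞)) (μ := ν.prod unifLaw)
    rw [← this, ← Measure.fst, Measure.fst_prod]
  have hreal : (bpLaw ν).real {t | level (n + 1) t ≤ ENNReal.ofReal p}ᶜ =
      ∫ x, (1 - p * pathProb ν n p) ^ x ∂ν := by
    rw [measureReal_def, key, ← integral_toReal (measurable_of_countable _).aemeasurable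
      (ae_of_all _ fun x => ENNReal.pow_lt_top ENNReal.ofReal_lt_top)]
    refine integral_congr_ae (ae_of_all _ fun x => ?_)
    simp only
    rw [ENNReal.toReal_pow, ENNReal.toReal_ofReal]
    nlinarith
  rw [pathProb, hitProb, ← hreal, probReal_compl_eq_one_sub hl]
  ring

/-- The probability of percolation at level `p`. -/
noncomputable def percProb (p : ℝ) : ℝ := (bpLaw ν).real {t | thr t ≤ ENNReal.ofReal p}

lemma tendsto_pathProb (p : ℝ) :
    Tendsto (fun n => pathProb ν n p) atTop (nhds (percProb ν p)) := by
  have e : {t | thr t ≤ ENNReal.ofReal p} = ⋂ n, {t | level n t ≤ ENNReal.ofReal p} := by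
    ext t; simp [thr]
  rw [percProb, e]
  refine (ENNReal.continuousAt_toReal (measure_ne_top _ _)).tendsto.comp ?_
  refine tendsto_measure_iInter_atTop
    (fun n => (measurableSet_le (by fun_prop) measurable_const).nullMeasurableSet) ?_
    ⟨0, measure_ne_top _ _⟩
  intro m n hmn t ht
  exact (level_monotone t hmn).trans ht

lemma percProb_nonneg (p : ℝ) : 0 ≤ percProb ν p := measureReal_nonneg

lemma percProb_le_one (p : ℝ) : percProb ν p ≤ 1 := measureReal_le_one

lemma percProb_eq {p : ℝ} (h0 : 0 ≤ p) (h1 : p ≤ 1) :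
    percProb ν p = hitProb ν (p * percProb ν p) := by
  have hin : ∀ x : ℝ, 0 ≤ x → x ≤ 1 → p * x ∈ Set.Icc (0 : ℝ) 1 := fun x hx hx' =>
    ⟨by positivity, by nlinarith⟩
  have hc := (continuousOn_hitProb ν) _ (hin _ (percProb_nonneg ν p) (percProb_le_one ν p))
  have ht : Tendsto (fun n => p * pathProb ν n p) atTop
      (nhdsWithin (p * percProb ν p) (Set.Icc 0 1)) :=
    tendsto_nhdsWithin_iff.2 ⟨(tendsto_pathProb ν p).const_mul p,
      Eventually.of_forall fun n => hin _ (pathProb_nonneg ν n p) (pathProb_le_one ν n p)⟩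
  refine tendsto_nhds_unique ((tendsto_add_atTop_iff_nat 1).2 (tendsto_pathProb ν p)) ?_
  simp only [pathProb_succ ν _ h0 h1]
  exact hc.tendsto.comp ht

/-- The recursion starts at `1` and is monotone, so its iterates stay above every subsolution `r`;
the limit is the largest fixed point. -/
lemma le_percProb {p r : ℝ} (h0 : 0 ≤ p) (h1 : p ≤ 1) (hr0 : 0 ≤ r) (hr1 : r ≤ 1)
    (hr : r ≤ hitProb ν (p * r)) : r ≤ percProb ν p := by
  refine ge_of_tendsto' (tendsto_pathProb ν p) fun n => ?_
  induction n with
  | zero => rwa [pathProb_zero]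
  | succ n ih =>
    rw [pathProb_succ ν n h0 h1]
    refine hr.trans (hitProb_mono ν (by positivity) (mul_le_mul_of_nonneg_left ih h0) ?_)
    nlinarith [pathProb_le_one ν n p, pathProb_nonneg ν n p]

variable {ν}

lemma ae_offspring_pos (hν0 : ν {0} = 0) : ∀ᵐ t ∂bpLaw ν, ∀ v, 1 ≤ (t v).1 := by
  refine ae_all_iff.2 fun v => ?_
  have h1 : ∀ᵐ x ∂ν, 1 ≤ x := by
    have : ∀ᵐ x ∂ν, x ∉ ({0} : Set ℕ) := measure_eq_zero_iff_ae_notMem.1 hν0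
    filter_upwards [this] with x hx
    exact Nat.one_le_iff_ne_zero.2 hx
  have h2 : ∀ᵐ e ∂ν.prod unifLaw, 1 ≤ e.1 :=
    Measure.quasiMeasurePreserving_fst.ae h1
  exact (measurePreserving_eval_infinitePi (fun _ : List ℕ => ν.prod unifLaw) v
    ).quasiMeasurePreserving.ae h2

lemma ae_weight {p : ℝ≥0∞ → Prop} (h : ∀ᵐ u ∂unifLaw, p u) :
    ∀ᵐ t ∂bpLaw ν, ∀ v, p (t v).2 :=
  ae_all_iff.2 fun v => (measurePreserving_eval_infinitePi (fun _ : List ℕ => ν.prod unifLaw) v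
    ).quasiMeasurePreserving.ae (Measure.quasiMeasurePreserving_snd.ae h)

lemma level_le_one {t : WTree} (h1 : ∀ v, 1 ≤ (t v).1) (h2 : ∀ v, (t v).2 ≤ 1) (n : ℕ) :
    level n t ≤ 1 := by
  induction n generalizing t with
  | zero => exact zero_le
  | succ n ih =>
    refine (Finset.inf_le (Finset.mem_range.2 (h1 []))).trans (max_le (h2 _) (ih ?_ ?_))
    · exact fun v => h1 _
    · exact fun v => h2 _

lemma thr_le_one {t : WTree} (h1 : ∀ v, 1 ≤ (t v).1) (h2 : ∀ v, (t v).2 ≤ 1) : thr t ≤ 1 :=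
  iSup_le fun n => level_le_one h1 h2 n

/-- The law of the percolation threshold has no atoms. -/
lemma thr_noAtoms (hν0 : ν {0} = 0) (hν2 : ν {x | 2 ≤ x} ≠ 0) (z : ℝ≥0∞) :
    bpLaw ν {t | thr t = z} = 0 := by
  rcases eq_or_ne z 0 with rfl | hz0
  · refine measure_eq_zero_iff_ae_notMem.2 ?_
    filter_upwards [ae_offspring_pos hν0, ae_weight (ν := ν) (p := fun u => u ≠ 0)
      (measure_eq_zero_iff_ae_notMem.1 (unifLaw_singleton 0))] with t h1 h2 h
    rw [thr_eq_inf] at h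
    have : (0 : ℝ≥0∞) < (Finset.range (t []).1).inf fun i => gate (sub i t) := by
      rw [Finset.lt_inf_iff ENNReal.zero_lt_top]
      exact fun i _ => lt_max_of_lt_left (pos_iff_ne_zero.2 (h2 _))
    exact this.ne' h
  rcases lt_or_ge 1 z with hz1 | hz1
  · refine measure_eq_zero_iff_ae_notMem.2 ?_
    filter_upwards [ae_offspring_pos hν0, ae_weight (ν := ν) ae_unifLaw_le_one] with t h1 h2 h
    exact absurd (thr_le_one h1 h2) (not_le.2 (hz1.trans_eq h.symm))
  obtain ⟨p, hp, rfl⟩ : ∃ p : ℝ, 0 < p ∧ z = ENNReal.ofReal p :=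
    ⟨z.toReal, ENNReal.toReal_pos hz0 (hz1.trans_lt ENNReal.one_lt_top).ne,
      (ENNReal.ofReal_toReal (hz1.trans_lt ENNReal.one_lt_top).ne).symm⟩
  have hp1 : p ≤ 1 := ENNReal.ofReal_le_one.1 hz1
  set a : ℝ := (bpLaw ν).real {t | thr t < ENNReal.ofReal p} with ha
  -- If this fails, take `r` strictly between `a` and `percProb ν p`. Strict concavity gives `r <
  -- hitProb ν (p * r)`, by continuity this persists at some `q < p`, and then `r ≤ percProb ν q ≤
  -- a`, a contradiction.
  have hle : percProb ν p ≤ a := by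
    by_contra! hab
    have hb0 : 0 < percProb ν p := lt_of_le_of_lt measureReal_nonneg hab
    have hb1 := percProb_le_one ν p
    obtain ⟨r, har, hrb⟩ := exists_between hab
    have hr0 : 0 < r := lt_of_le_of_lt measureReal_nonneg har
    have hr : r < hitProb ν (p * r) := by
      -- With this choice `l * s = p * r`, and the fixed-point equation turns `l * hitProb ν s` into
      -- `r`.
      have := mul_hitProb_lt ν hν2 (s := p * percProb ν p) (l := r / percProb ν p)
        (by positivity) (by nlinarith) (by positivity) ((div_lt_one hb0).2 hrb)
      rw [← percProb_eq ν hp.le hp1, div_mul_cancel₀ _ hb0.ne'] at this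
      rwa [show r / percProb ν p * (p * percProb ν p) = p * r by field_simp] at this
    have hin : ∀ q ∈ Set.Icc 0 p, q * r ∈ Set.Icc (0 : ℝ) 1 := fun q hq =>
      ⟨mul_nonneg hq.1 hr0.le, by nlinarith [hq.1, hq.2]⟩
    have hcont : ContinuousOn (fun q => hitProb ν (q * r)) (Set.Icc 0 p) :=
      (continuousOn_hitProb ν).comp (by fun_prop) hin
    have hev : ∀ᶠ q in nhdsWithin p (Set.Icc 0 p), r < hitProb ν (q * r) :=
      (hcont p ⟨hp.le, le_rfl⟩).eventually (lt_mem_nhds hr)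
    have hev' : ∀ᶠ q in nhdsWithin p (Set.Ico 0 p), r < hitProb ν (q * r) :=
      hev.filter_mono (nhdsWithin_mono _ Set.Ico_subset_Icc_self)
    have hne : (nhdsWithin p (Set.Ico 0 p)).NeBot := by
      rw [nhdsWithin_Ico_eq_nhdsLT hp]; infer_instance
    obtain ⟨q, hq, hq'⟩ := (hev'.and self_mem_nhdsWithin).exists
    have h1 := le_percProb ν hq'.1 (hq'.2.le.trans hp1) hr0.le (hrb.le.trans hb1) hq.le
    have h2 : percProb ν q ≤ a := by
      refine measureReal_mono (fun t ht => ?_) (measure_ne_top _ _)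
      exact lt_of_le_of_lt ht ((ENNReal.ofReal_lt_ofReal_iff hp).2 hq'.2)
    linarith
  have hd : {t | thr t = ENNReal.ofReal p} =
      {t | thr t ≤ ENNReal.ofReal p} \ {t | thr t < ENNReal.ofReal p} := by
    ext t
    simp only [Set.mem_ofPred_eq, Set.mem_sdiff, not_lt]
    exact ⟨fun h => ⟨h.le, h.ge⟩, fun h => le_antisymm h.1 h.2⟩
  have hm : MeasurableSet {t | thr t < ENNReal.ofReal p} :=
    measurableSet_lt measurable_thr measurable_const
  have h0 : (bpLaw ν).real {t | thr t = ENNReal.ofReal p} ≤ 0 := by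
    have hsub : {t | thr t < ENNReal.ofReal p} ⊆ {t | thr t ≤ ENNReal.ofReal p} :=
      fun t ht => le_of_lt (show thr t < ENNReal.ofReal p from ht)
    rw [hd, measureReal_sdiff hsub hm]
    simpa [percProb, ha] using hle
  rwa [← measureReal_eq_zero_iff (measure_ne_top _ _), ← measureReal_nonneg.ge_iff_eq']

lemma gate_noAtoms (hν0 : ν {0} = 0) (hν2 : ν {x | 2 ≤ x} ≠ 0) (z : ℝ≥0∞) :
    bpLaw ν {t | gate t = z} = 0 := by
  refine measure_mono_null (t := {t | (t []).2 = z} ∪ {t | thr t = z}) (fun t ht => ?_)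
    (measure_union_null ?_ (thr_noAtoms hν0 hν2 z))
  · rcases max_choice (t []).2 (thr t) with h | h
    · exact .inl (h.symm.trans ht)
    · exact .inr (h.symm.trans ht)
  · have := ae_weight (ν := ν) (p := fun u => u ≠ z)
      (measure_eq_zero_iff_ae_notMem.1 (unifLaw_singleton z))
    refine measure_eq_zero_iff_ae_notMem.2 ?_
    filter_upwards [this] with t ht using ht []

/-- Almost surely, at every vertex the threshold is attained through exactly one child. -/
lemma ae_exists_isBest (hν0 : ν {0} = 0) (hν2 : ν {x | 2 ≤ x} ≠ 0) :
    ∀ᵐ t ∂bpLaw ν, IsBest t (best t) := by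
  -- Gates of different children are independent without atoms, so ties have probability zero.
  have : ∀ᵐ t ∂bpLaw ν, ∀ i j, i ≠ j → gate (sub i t) ≠ gate (sub j t) := by
    refine ae_all_iff.2 fun i => ae_all_iff.2 fun j => ?_
    by_cases hij : i = j
    · exact ae_of_all _ fun _ h => absurd hij h
    · filter_upwards [ae_ne_of_noAtoms _ hij measurable_gate measurable_gate
        (gate_noAtoms hν0 hν2)] with t ht _ using ht
  filter_upwards [this, ae_offspring_pos hν0] with t ht h1
  obtain ⟨i, hi, hmin⟩ := Finset.exists_min_image (Finset.range (t []).1) (fun i => gate (sub i t))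
    ⟨0, Finset.mem_range.2 (h1 [])⟩
  have hb : IsBest t i := ⟨Finset.mem_range.1 hi, fun j hj hji =>
    lt_of_le_of_ne (hmin j (Finset.mem_range.2 hj)) (ht i j hji.symm)⟩
  rwa [hb.best_eq]

end Threshold

/-! ### The Markov structure along the backbone -/

section Markov

set_option linter.unusedSectionVars false

open Classical in
/-- The contribution to `dens` of the `i`-th child of a vertex with data `p`. -/
noncomputable def densTerm (f : ℝ≥0∞ → ℝ≥0∞) (i : ℕ) (z : ℝ≥0∞)
    (p : (ℕ × ℝ≥0∞) × (ℕ → WTree)) : ℝ≥0∞ :=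
  if i < p.1.1 ∧ ∀ j < p.1.1, j ≠ i → z < gate (p.2 j) then f (hangingWeight z i p.1.1 p.2) else 0

/-- The density at `s` of the law of the subtree of the best child, weighted by `f` of the forest
weight, relative to the law of the whole tree, as a function of the gate `z` of `s`. -/
noncomputable def dens (ν : Measure ℕ) (f : ℝ≥0∞ → ℝ≥0∞) (z : ℝ≥0∞) : ℝ≥0∞ :=
  ∑' i, ∫⁻ p, densTerm f i z p ∂(ν.prod unifLaw).prod (Measure.infinitePi fun _ : ℕ => bpLaw ν)

lemma measurable_densTerm {f : ℝ≥0∞ → ℝ≥0∞} (hf : Measurable f) (i : ℕ) :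
    Measurable fun q : ℝ≥0∞ × ((ℕ × ℝ≥0∞) × (ℕ → WTree)) => densTerm f i q.1 q.2 := by
  classical
  unfold densTerm
  refine Measurable.ite ?_ (hf.comp ?_) measurable_const
  · have : {q : ℝ≥0∞ × ((ℕ × ℝ≥0∞) × (ℕ → WTree)) | i < q.2.1.1 ∧
        ∀ j < q.2.1.1, j ≠ i → q.1 < gate (q.2.2 j)} = {q | i < q.2.1.1} ∩
          ⋂ j, ({q | j < q.2.1.1}ᶜ ∪ {_q | j = i} ∪ {q | q.1 < gate (q.2.2 j)}) := by
      ext q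
      simp only [Set.mem_ofPred_eq, Set.mem_inter_iff, Set.mem_iInter, Set.mem_union,
        Set.mem_compl_iff]
      refine and_congr_right fun _ => forall_congr' fun j => ?_
      tauto
    rw [this]
    refine (measurableSet_lt measurable_const (by fun_prop)).inter (.iInter fun j =>
      (((measurableSet_lt measurable_const (by fun_prop)).compl).union (.const _)).union
        (measurableSet_lt (by fun_prop) (by fun_prop)))
  · exact measurable_hangingWeight.comp (f := fun q : ℝ≥0∞ × ((ℕ × ℝ≥0∞) × (ℕ → WTree)) =>
      (((q.1, i), q.2.1.1), q.2.2)) (by fun_prop)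

/-- With the gate of the `i`-th child replaced by a free parameter `z`, the `i`-th subtree no longer
occurs. -/
lemma densTerm_update (f : ℝ≥0∞ → ℝ≥0∞) (i : ℕ) (z : ℝ≥0∞) (e : ℕ × ℝ≥0∞) (ξ : ℕ → WTree)
    (s : WTree) : densTerm f i z (e, Function.update ξ i s) = densTerm f i z (e, ξ) := by
  have h1 : hangingWeight z i e.1 (Function.update ξ i s) = hangingWeight z i e.1 ξ := by
    refine Finset.sum_congr rfl fun j _ => ?_
    split_ifs with h
    · rfl
    · rw [Function.update_of_ne h]
  have h2 : (∀ j < e.1, j ≠ i → z < gate (Function.update ξ i s j)) ↔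
      ∀ j < e.1, j ≠ i → z < gate (ξ j) :=
    forall₃_congr fun j _ h => by rw [Function.update_of_ne h]
  simp only [densTerm, h1, h2]

variable {ν : Measure ℕ} [IsProbabilityMeasure ν]

lemma measurable_dens {f : ℝ≥0∞ → ℝ≥0∞} (hf : Measurable f) : Measurable (dens ν f) :=
  Measurable.tsum fun i => (measurable_densTerm hf i).lintegral_prod_right'

/-- The `i`-th subtree enters only through its gate and `H`, so it may be replaced by an independent
copy `s`; Fubini then integrates the other subtrees at fixed `s`. -/
lemma lintegral_densTerm {f : ℝ≥0∞ → ℝ≥0∞} (hf : Measurable f) {H : WTree → ℝ≥0∞}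
    (hH : Measurable H) (i : ℕ) :
    ∫⁻ t, densTerm f i (gate (sub i t)) (t [], fun j => sub j t) * H (sub i t) ∂bpLaw ν =
      ∫⁻ s, (∫⁻ p, densTerm f i (gate s) p
        ∂(ν.prod unifLaw).prod (Measure.infinitePi fun _ : ℕ => bpLaw ν)) * H s ∂bpLaw ν := by
  have hm : Measurable fun q : WTree × ((ℕ × ℝ≥0∞) × (ℕ → WTree)) =>
      densTerm f i (gate q.1) q.2 * H q.1 :=
    ((measurable_densTerm hf i).comp (f := fun q : WTree × ((ℕ × ℝ≥0∞) × (ℕ → WTree)) =>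
      (gate q.1, q.2)) (by fun_prop)).mul (hH.comp measurable_fst)
  have hG : Measurable fun p : (ℕ × ℝ≥0∞) × (ℕ → WTree) =>
      densTerm f i (gate (p.2 i)) p * H (p.2 i) :=
    hm.comp (f := fun p : (ℕ × ℝ≥0∞) × (ℕ → WTree) => (p.2 i, p)) (by fun_prop)
  have e1 := lintegral_root_subtrees (ν.prod unifLaw) hG
  simp only at e1
  rw [e1, lintegral_prod _ hG.aemeasurable]
  have e2 : ∀ e : ℕ × ℝ≥0∞,
      ∫⁻ ξ, densTerm f i (gate (ξ i)) (e, ξ) * H (ξ i) ∂(Measure.infinitePi fun _ : ℕ => bpLaw ν) =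
      ∫⁻ ξ, ∫⁻ s, densTerm f i (gate s) (e, ξ) * H s ∂bpLaw ν
        ∂(Measure.infinitePi fun _ : ℕ => bpLaw ν) := by
    intro e
    have hGe : Measurable fun ξ : ℕ → WTree => densTerm f i (gate (ξ i)) (e, ξ) * H (ξ i) :=
      hG.comp (measurable_const.prodMk measurable_id)
    rw [lintegral_infinitePi_update (fun _ : ℕ => bpLaw ν) i hGe]
    simp only [densTerm_update, Function.update_self]
  simp only [e2]
  have hm' : Measurable fun q : ((ℕ × ℝ≥0∞) × (ℕ → WTree)) × WTree =>
      densTerm f i (gate q.2) q.1 * H q.2 := hm.comp measurable_swap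
  rw [← lintegral_prod (fun p : (ℕ × ℝ≥0∞) × (ℕ → WTree) =>
    ∫⁻ s, densTerm f i (gate s) p * H s ∂bpLaw ν) hm'.lintegral_prod_right'.aemeasurable,
    lintegral_lintegral_swap hm'.aemeasurable]
  refine lintegral_congr fun s => ?_
  exact lintegral_mul_const _
    ((measurable_densTerm hf i).comp (measurable_const.prodMk measurable_id))

/-- The joint law of the forest weight at the root and the subtree of the best child. -/
lemma lintegral_forest_next (hν0 : ν {0} = 0) (hν2 : ν {x | 2 ≤ x} ≠ 0) {f : ℝ≥0∞ → ℝ≥0∞}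
    (hf : Measurable f) {H : WTree → ℝ≥0∞} (hH : Measurable H) :
    ∫⁻ t, f (forest t) * H (next t) ∂bpLaw ν = ∫⁻ s, dens ν f (gate s) * H s ∂bpLaw ν := by
  -- Decomposition over the identity of the best child: almost surely one term survives, and there
  -- the gate of the child is the threshold at which `forest` is computed.
  have h1 : ∀ᵐ t ∂bpLaw ν, f (forest t) * H (next t) =
      ∑' i, densTerm f i (gate (sub i t)) (t [], fun j => sub j t) * H (sub i t) := by
    filter_upwards [ae_exists_isBest hν0 hν2] with t ht
    rw [tsum_eq_single (best t)]
    · have e : densTerm f (best t) (gate (sub (best t) t)) (t [], fun j => sub j t) =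
          f (hangingWeight (gate (sub (best t) t)) (best t) (t []).1 fun j => sub j t) := if_pos ht
      rw [e, ← ht.thr_eq]
      rfl
    · intro i hi
      have : ¬ IsBest t i := fun h => hi h.best_eq.symm
      have e : densTerm f i (gate (sub i t)) (t [], fun j => sub j t) = 0 := if_neg this
      rw [e, zero_mul]
  rw [lintegral_congr_ae h1, lintegral_tsum]
  · simp only [lintegral_densTerm hf hH]
    rw [← lintegral_tsum]
    · simp only [ENNReal.tsum_mul_right]
      rfl
    · intro i
      exact (((measurable_densTerm hf i).lintegral_prod_right'.comp measurable_gate).mul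
        hH).aemeasurable
  · intro i
    refine Measurable.aemeasurable (Measurable.mul ?_ (hH.comp (measurable_sub i)))
    exact (measurable_densTerm hf i).comp (f := fun t : WTree =>
      (gate (sub i t), (t [], fun j => sub j t))) (by fun_prop)

open Classical in
/-- The conditional expectation of `f` of the forest weight at the root, given that the threshold
is `z`. -/
noncomputable def forestMean (ν : Measure ℕ) (f : ℝ≥0∞ → ℝ≥0∞) (z : ℝ≥0∞) : ℝ≥0∞ :=
  if dens ν (fun _ => 1) z = 0 ∨ dens ν (fun _ => 1) z = ⊤ then f 0
  else dens ν f z / dens ν (fun _ => 1) z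

open Classical in
/-- The conditional expectation of `g` of the weight of a backbone edge, given that the thresholds
of its endpoints are `z` and `r`. -/
noncomputable def edgeMean (g : ℝ≥0∞ → ℝ≥0∞) (z r : ℝ≥0∞) : ℝ≥0∞ :=
  if r < z then g z
  else if unifLaw (Set.Iic r) = 0 then g 0
  else (∫⁻ u in Set.Iic r, g u ∂unifLaw) / unifLaw (Set.Iic r)

lemma measurable_forestMean {f : ℝ≥0∞ → ℝ≥0∞} (hf : Measurable f) :
    Measurable (forestMean ν f) := by
  have h1 : Measurable (dens ν fun _ => 1) := measurable_dens measurable_const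
  refine Measurable.ite ?_ measurable_const ((measurable_dens hf).div h1)
  exact (h1 (measurableSet_singleton 0)).union (h1 (measurableSet_singleton ⊤))

/-- The default value `f 0`, the mean under a point mass, makes this hold at exceptional `z` too, so
pieces that are not tested contribute a factor exactly `1`. -/
lemma forestMean_one (z : ℝ≥0∞) : forestMean ν (fun _ => 1) z = 1 := by
  unfold forestMean
  split_ifs with h
  · rfl
  · push Not at h
    exact ENNReal.div_self h.1 h.2

lemma measurable_unifLaw_Iic : Measurable fun r : ℝ≥0∞ => unifLaw (Set.Iic r) :=
  (monotone_iff_forall_lt.2 fun _ _ h => measure_mono (Set.Iic_subset_Iic.2 h.le)).measurable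

lemma measurable_edgeMean {g : ℝ≥0∞ → ℝ≥0∞} (hg : Measurable g) :
    Measurable fun p : ℝ≥0∞ × ℝ≥0∞ => edgeMean g p.1 p.2 := by
  have h1 : Measurable fun r : ℝ≥0∞ => ∫⁻ u in Set.Iic r, g u ∂unifLaw :=
    (monotone_iff_forall_lt.2 fun _ _ h =>
      lintegral_mono_set (Set.Iic_subset_Iic.2 h.le)).measurable
  refine Measurable.ite (measurableSet_lt measurable_snd measurable_fst)
    (hg.comp measurable_fst) (Measurable.ite ?_ measurable_const ?_)
  · exact (measurable_unifLaw_Iic.comp measurable_snd) (measurableSet_singleton 0)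
  · exact (h1.comp measurable_snd).div (measurable_unifLaw_Iic.comp measurable_snd)

lemma edgeMean_one (z r : ℝ≥0∞) : edgeMean (fun _ => 1) z r = 1 := by
  unfold edgeMean
  split_ifs with h h'
  · rfl
  · rfl
  · rw [setLIntegral_one]
    exact ENNReal.div_self h' (measure_ne_top _ _)

/-- Conditioning a uniform `u` on `max u r`: above `r` the maximum reveals `u`, and at `r` it only
says that `u` lies in `Set.Iic r`. The integral is split accordingly. -/
lemma lintegral_edgeMean {g U : ℝ≥0∞ → ℝ≥0∞} (hg : Measurable g) (r : ℝ≥0∞) :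
    ∫⁻ u, g u * U (max u r) ∂unifLaw =
      ∫⁻ u, edgeMean g (max u r) r * U (max u r) ∂unifLaw := by
  rw [← lintegral_add_compl _ (measurableSet_Iic (a := r)),
    ← lintegral_add_compl (fun u => edgeMean g (max u r) r * U (max u r))
      (measurableSet_Iic (a := r))]
  congr 1
  · have e1 : ∫⁻ u in Set.Iic r, g u * U (max u r) ∂unifLaw =
        (∫⁻ u in Set.Iic r, g u ∂unifLaw) * U r := by
      rw [← lintegral_mul_const _ hg]
      refine setLIntegral_congr_fun measurableSet_Iic fun u hu => ?_
      simp only [max_eq_right hu.out]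
    have e2 : ∫⁻ u in Set.Iic r, edgeMean g (max u r) r * U (max u r) ∂unifLaw =
        edgeMean g r r * U r * unifLaw (Set.Iic r) := by
      rw [← setLIntegral_const]
      refine setLIntegral_congr_fun measurableSet_Iic fun u hu => ?_
      simp only [max_eq_right hu.out]
    rw [e1, e2, edgeMean, if_neg (lt_irrefl r)]
    split_ifs with h
    · rw [h, mul_zero, setLIntegral_measure_zero _ _ h, zero_mul]
    · rw [mul_right_comm, ENNReal.div_mul_cancel h (measure_ne_top _ _)]
  · refine setLIntegral_congr_fun measurableSet_Iic.compl fun u hu => ?_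
    have hu : r < u := not_le.1 hu
    simp only [max_eq_left hu.le, edgeMean, if_pos hu]

/-- The density for `f = 1` has integral `1`, hence is almost surely finite; where it vanishes, so
does the density for any `f ≤ 1`. The defaults in `forestMean` are therefore harmless. -/
lemma ae_dens_eq (hν0 : ν {0} = 0) (hν2 : ν {x | 2 ≤ x} ≠ 0) {f : ℝ≥0∞ → ℝ≥0∞}
    (hf1 : ∀ x, f x ≤ 1) :
    ∀ᵐ s ∂bpLaw ν, dens ν f (gate s) = dens ν (fun _ => 1) (gate s) * forestMean ν f (gate s) := by
  have hm : Measurable fun s => dens ν (fun _ => 1) (gate s) :=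
    (measurable_dens measurable_const).comp measurable_gate
  have hfin : ∀ᵐ s ∂bpLaw ν, dens ν (fun _ => 1) (gate s) < ⊤ := by
    refine ae_lt_top hm ?_
    have := lintegral_forest_next hν0 hν2 (f := fun _ => 1) measurable_const
      (H := fun _ => 1) measurable_const
    simp only [mul_one, lintegral_one, measure_univ] at this
    rw [← this]
    exact ENNReal.one_ne_top
  filter_upwards [hfin] with s hs
  have hle : dens ν f (gate s) ≤ dens ν (fun _ => 1) (gate s) := by
    refine ENNReal.tsum_le_tsum fun i => lintegral_mono fun p => ?_
    unfold densTerm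
    split_ifs
    · exact hf1 _
    · exact le_rfl
  unfold forestMean
  split_ifs with h
  · rcases h with h | h
    · rw [h] at hle ⊢
      rw [zero_mul]
      exact le_zero_iff.1 hle
    · exact absurd h hs.ne
  · push Not at h
    exact (ENNReal.mul_div_cancel h.1 h.2).symm

/-- The thresholds along the backbone. -/
noncomputable def thresholds (t : WTree) (k : ℕ) : ℝ≥0∞ := thr (next^[k] t)

/-- The sequence `a, z 0, z 1, …`. -/
def consSeq (a : ℝ≥0∞) (z : ℕ → ℝ≥0∞) : ℕ → ℝ≥0∞
  | 0 => a
  | k + 1 => z k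

lemma measurable_consSeq : Measurable fun p : ℝ≥0∞ × (ℕ → ℝ≥0∞) => consSeq p.1 p.2 := by
  refine measurable_pi_iff.2 fun k => ?_
  cases k with
  | zero => exact measurable_fst
  | succ k => exact (measurable_pi_apply k).comp measurable_snd

@[fun_prop]
lemma measurable_thresholds : Measurable thresholds :=
  measurable_pi_iff.2 fun k => measurable_thr.comp (measurable_next.iterate k)

/-- A product of functions of the forest weights and of the backbone weights. -/
noncomputable def obsProd (f g : ℕ → ℝ≥0∞ → ℝ≥0∞) (n : ℕ) (t : WTree) : ℝ≥0∞ :=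
  ∏ i ∈ Finset.range n, f i (forest (next^[i] t)) * g i (next^[i + 1] t []).2

/-- The product of the conditional means of the factors of `obsProd`. -/
noncomputable def meanProd (ν : Measure ℕ) (f g : ℕ → ℝ≥0∞ → ℝ≥0∞) (n : ℕ) (z : ℕ → ℝ≥0∞) :
    ℝ≥0∞ :=
  ∏ i ∈ Finset.range n, forestMean ν (f i) (z i) * edgeMean (g i) (z i) (z (i + 1))

lemma measurable_obsProd {f g : ℕ → ℝ≥0∞ → ℝ≥0∞} (hf : ∀ i, Measurable (f i))
    (hg : ∀ i, Measurable (g i)) (n : ℕ) : Measurable (obsProd f g n) := by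
  refine Finset.measurable_prod _ fun i _ => Measurable.mul ?_ ?_
  · exact (hf i).comp (measurable_forest.comp (measurable_next.iterate i))
  · exact (hg i).comp (measurable_snd.comp
      ((measurable_pi_apply []).comp (measurable_next.iterate (i + 1))))

lemma measurable_meanProd {f g : ℕ → ℝ≥0∞ → ℝ≥0∞} (hf : ∀ i, Measurable (f i))
    (hg : ∀ i, Measurable (g i)) (n : ℕ) : Measurable (meanProd ν f g n) := by
  refine Finset.measurable_prod _ fun i _ => Measurable.mul ?_ ?_
  · exact (measurable_forestMean (hf i)).comp (measurable_pi_apply i)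
  · exact (measurable_edgeMean (hg i)).comp
      (f := fun z : ℕ → ℝ≥0∞ => (z i, z (i + 1))) (by fun_prop)

lemma thresholds_setRoot (t : WTree) (u : ℝ≥0∞) : thresholds (setRoot t u) = thresholds t := by
  funext k
  cases k with
  | zero => exact thr_setRoot t u
  | succ k => simp only [thresholds, Function.iterate_succ_apply, next_setRoot]

lemma obsProd_setRoot (f g : ℕ → ℝ≥0∞ → ℝ≥0∞) (n : ℕ) (t : WTree) (u : ℝ≥0∞) :
    obsProd f g n (setRoot t u) = obsProd f g n t := by
  refine Finset.prod_congr rfl fun i _ => ?_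
  cases i with
  | zero => simp only [Function.iterate_succ_apply, Function.iterate_zero, id, next_setRoot,
      forest_setRoot]
  | succ i => simp only [Function.iterate_succ_apply, next_setRoot]

/-- The first threshold is the gate of the best child, so the whole sequence is a functional of
`next t`, as `lintegral_forest_next` requires. -/
lemma ae_thresholds_eq (hν0 : ν {0} = 0) (hν2 : ν {x | 2 ≤ x} ≠ 0) :
    ∀ᵐ t ∂bpLaw ν, thresholds t = consSeq (gate (next t)) (thresholds (next t)) := by
  filter_upwards [ae_exists_isBest hν0 hν2] with t ht
  funext k
  cases k with
  | zero => exact ht.thr_eq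
  | succ k => rfl

/-- Given the thresholds along the backbone, the forest weights and the weights of the backbone
edges are independent. -/
lemma lintegral_obsProd (hν0 : ν {0} = 0) (hν2 : ν {x | 2 ≤ x} ≠ 0) (n : ℕ) :
    ∀ {f g : ℕ → ℝ≥0∞ → ℝ≥0∞}, (∀ i, Measurable (f i)) → (∀ i, Measurable (g i)) →
      (∀ i x, f i x ≤ 1) → ∀ {Φ : (ℕ → ℝ≥0∞) → ℝ≥0∞}, Measurable Φ →
      ∫⁻ t, Φ (thresholds t) * obsProd f g n t ∂bpLaw ν =
        ∫⁻ t, Φ (thresholds t) * meanProd ν f g n (thresholds t) ∂bpLaw ν := by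
  -- The step strips the first backbone vertex. It uses the hypothesis for shifted families and for
  -- a `Φ` that depends on a resampled weight, so all of these stay quantified.
  induction n with
  | zero => intros; simp [obsProd, meanProd]
  | succ n ih =>
    intro f g hf hg hf1 Φ hΦ
    set f' : ℕ → ℝ≥0∞ → ℝ≥0∞ := fun i => f (i + 1)
    set g' : ℕ → ℝ≥0∞ → ℝ≥0∞ := fun i => g (i + 1)
    have hO := measurable_obsProd (fun i => hf (i + 1)) (fun i => hg (i + 1)) n
    have hM := measurable_meanProd (ν := ν) (fun i => hf (i + 1)) (fun i => hg (i + 1)) n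
    have hcons : Measurable fun s : WTree => Φ (consSeq (gate s) (thresholds s)) :=
      hΦ.comp (measurable_consSeq.comp (measurable_gate.prodMk measurable_thresholds))
    have hd := measurable_dens (ν := ν) (hf 0)
    let H : WTree → ℝ≥0∞ := fun s =>
      g 0 (s []).2 * Φ (consSeq (gate s) (thresholds s)) * obsProd f' g' n s
    have hH : Measurable H := (((hg 0).comp (by fun_prop)).mul hcons).mul hO
    -- The counterpart of `H` on the mean side, with the forest mean included: it will be used with
    -- `f = 1`.
    let H' : WTree → ℝ≥0∞ := fun s =>
      forestMean ν (f 0) (gate s) * edgeMean (g 0) (gate s) (thr s) *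
      Φ (consSeq (gate s) (thresholds s)) * meanProd ν f' g' n (thresholds s)
    have hE : Measurable fun s : WTree => edgeMean (g 0) (gate s) (thr s) :=
      (measurable_edgeMean (hg 0)).comp (measurable_gate.prodMk measurable_thr)
    have hH' : Measurable H' :=
      ((((measurable_forestMean (hf 0)).comp measurable_gate).mul hE).mul hcons).mul
        (hM.comp measurable_thresholds)
    have L : ∫⁻ t, Φ (thresholds t) * obsProd f g (n + 1) t ∂bpLaw ν =
        ∫⁻ t, f 0 (forest t) * H (next t) ∂bpLaw ν := by
      refine lintegral_congr_ae ?_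
      filter_upwards [ae_thresholds_eq hν0 hν2] with t ht
      rw [ht, obsProd, Finset.prod_range_succ']
      simp only [Function.iterate_succ_apply, Function.iterate_zero, id, H, obsProd, f', g']
      ring
    have R : ∫⁻ t, Φ (thresholds t) * meanProd ν f g (n + 1) (thresholds t) ∂bpLaw ν =
        ∫⁻ t, (1 : ℝ≥0∞) * H' (next t) ∂bpLaw ν := by
      refine lintegral_congr_ae ?_
      filter_upwards [ae_thresholds_eq hν0 hν2] with t ht
      rw [ht, meanProd, Finset.prod_range_succ']
      simp only [H', meanProd, f', g']
      have e : consSeq (gate (next t)) (thresholds (next t)) (0 + 1) = thr (next t) := rfl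
      have e0 : consSeq (gate (next t)) (thresholds (next t)) 0 = gate (next t) := rfl
      have e1 : ∀ k, consSeq (gate (next t)) (thresholds (next t)) (k + 1) =
        thresholds (next t) k := fun _ => rfl
      simp only [e, e0, e1]
      ring
    rw [L, R, lintegral_forest_next hν0 hν2 (hf 0) hH,
      lintegral_forest_next hν0 hν2 (f := fun _ => 1) measurable_const hH',
      lintegral_setRoot ν unifLaw (H := fun s => dens ν (f 0) (gate s) * H s)
        ((hd.comp measurable_gate).mul hH)]
    -- After resampling the weight `u`, all factors but `obsProd` depend on `u` and the thresholds
    -- only; for fixed `u` this is an admissible test function for the induction hypothesis.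
    let Ψ : ℝ≥0∞ → (ℕ → ℝ≥0∞) → ℝ≥0∞ := fun u z =>
      dens ν (f 0) (max u (z 0)) * g 0 u * Φ (consSeq (max u (z 0)) z)
    have hΨ : Measurable fun p : ℝ≥0∞ × (ℕ → ℝ≥0∞) => Ψ p.1 p.2 := by
      refine ((hd.comp (by fun_prop)).mul ((hg 0).comp measurable_fst)).mul
        (hΦ.comp (measurable_consSeq.comp (f := fun p : ℝ≥0∞ × (ℕ → ℝ≥0∞) =>
          (max p.1 (p.2 0), p.2)) (by fun_prop)))
    have hΨt : Measurable fun p : WTree × ℝ≥0∞ => Ψ p.2 (thresholds p.1) :=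
      hΨ.comp (f := fun p : WTree × ℝ≥0∞ => (p.2, thresholds p.1)) (by fun_prop)
    calc ∫⁻ t, ∫⁻ u, dens ν (f 0) (gate (setRoot t u)) * H (setRoot t u) ∂unifLaw ∂bpLaw ν
        = ∫⁻ t, ∫⁻ u, Ψ u (thresholds t) * obsProd f' g' n t ∂unifLaw ∂bpLaw ν := by
          refine lintegral_congr fun t => lintegral_congr fun u => ?_
          simp only [H, Ψ, gate_setRoot, thresholds_setRoot, obsProd_setRoot, setRoot_nil]
          rw [show thresholds t 0 = thr t from rfl]
          ring
      _ = ∫⁻ u, ∫⁻ t, Ψ u (thresholds t) * obsProd f' g' n t ∂bpLaw ν ∂unifLaw :=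
          lintegral_lintegral_swap (hΨt.mul (hO.comp measurable_fst)).aemeasurable
      _ = ∫⁻ u, ∫⁻ t, Ψ u (thresholds t) * meanProd ν f' g' n (thresholds t) ∂bpLaw ν ∂unifLaw := by
          refine lintegral_congr fun u => ?_
          exact ih (fun i => hf (i + 1)) (fun i => hg (i + 1)) (fun i => hf1 (i + 1))
            (Φ := Ψ u) (hΨ.comp (measurable_const.prodMk measurable_id))
      _ = ∫⁻ t, ∫⁻ u, Ψ u (thresholds t) * meanProd ν f' g' n (thresholds t) ∂unifLaw ∂bpLaw ν :=
          (lintegral_lintegral_swap (hΨt.mul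
            (hM.comp (measurable_thresholds.comp measurable_fst))).aemeasurable).symm
      _ = ∫⁻ t, ∫⁻ u, dens ν (f 0) (gate (setRoot t u)) *
            (edgeMean (g 0) (gate (setRoot t u)) (thr (setRoot t u)) *
              Φ (consSeq (gate (setRoot t u)) (thresholds (setRoot t u))) *
              meanProd ν f' g' n (thresholds (setRoot t u))) ∂unifLaw ∂bpLaw ν := by
          refine lintegral_congr fun t => ?_
          -- At a fixed tree, the remaining factors see `u` only through its maximum with `thr t`,
          -- so `g 0 u` may be replaced by its conditional mean.
          have := lintegral_edgeMean (U := fun m : ℝ≥0∞ => dens ν (f 0) m *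
            Φ (consSeq m (thresholds t)) * meanProd ν f' g' n (thresholds t)) (hg 0) (thr t)
          simp only [gate_setRoot, thresholds_setRoot, thr_setRoot]
          calc _ = ∫⁻ u, g 0 u * (dens ν (f 0) (max u (thr t)) *
                Φ (consSeq (max u (thr t)) (thresholds t)) *
                meanProd ν f' g' n (thresholds t)) ∂unifLaw := by
                refine lintegral_congr fun u => ?_
                simp only [Ψ]
                rw [show thresholds t 0 = thr t from rfl]
                ring
            _ = _ := this
            _ = _ := lintegral_congr fun u => by ring
      _ = ∫⁻ s, dens ν (f 0) (gate s) * (edgeMean (g 0) (gate s) (thr s) *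
              Φ (consSeq (gate s) (thresholds s)) * meanProd ν f' g' n (thresholds s)) ∂bpLaw ν :=
          (lintegral_setRoot ν unifLaw (H := fun s => dens ν (f 0) (gate s) *
            (edgeMean (g 0) (gate s) (thr s) * Φ (consSeq (gate s) (thresholds s)) *
              meanProd ν f' g' n (thresholds s))) ((hd.comp measurable_gate).mul
            ((hE.mul hcons).mul (hM.comp measurable_thresholds)))).symm
      _ = ∫⁻ s, dens ν (fun _ => 1) (gate s) * H' s ∂bpLaw ν := by
          refine lintegral_congr_ae ?_
          filter_upwards [ae_dens_eq hν0 hν2 (hf1 0)] with s hs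
          rw [hs]
          simp only [H']
          ring

end Markov

/-! ### Invasion percolation on a fixed tree -/

section Deterministic

/-- The weighted tree with offspring numbers `X` and weights `w`. -/
noncomputable def toTree (X : List ℕ → ℕ) (w : List ℕ → ℝ) : WTree :=
  fun v => (X v, ENNReal.ofReal (w v))

/-- The generic trees: every vertex has a child, the weights are at most one, at every vertex the
threshold is attained through a single child, and it differs from the weights of the edges in the
subtrees of the other children. -/
structure Generic (t : WTree) : Prop where
  pos : ∀ v, 1 ≤ (t v).1
  le_one : ∀ v, (t v).2 ≤ 1
  isBest : ∀ v, IsBest (shift v t) (best (shift v t))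
  ne_gate : ∀ v i j s, i ≠ j → (sub i (shift v t) s).2 ≠ gate (sub j (shift v t))

/-- The conditions on thresholds are almost sure at the root; shifts preserve the law and there are
countably many vertices. -/
lemma ae_generic {ν : Measure ℕ} [IsProbabilityMeasure ν] (hν0 : ν {0} = 0)
    (hν2 : ν {x | 2 ≤ x} ≠ 0) : ∀ᵐ t ∂bpLaw ν, Generic t := by
  have h3 : ∀ᵐ t ∂bpLaw ν, ∀ v, IsBest (shift v t) (best (shift v t)) :=
    ae_all_iff.2 fun v => (measurePreserving_shift (ν.prod unifLaw) v).quasiMeasurePreserving.ae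
      (ae_exists_isBest hν0 hν2)
  have h4 : ∀ᵐ t ∂bpLaw ν, ∀ v i j s, i ≠ j →
      (sub i (shift v t) s).2 ≠ gate (sub j (shift v t)) := by
    refine ae_all_iff.2 fun v => (measurePreserving_shift
      (ν.prod unifLaw) v).quasiMeasurePreserving.ae
      (p := fun t => ∀ i j s, i ≠ j → (sub i t s).2 ≠ gate (sub j t)) ?_
    refine ae_all_iff.2 fun i => ae_all_iff.2 fun j => ae_all_iff.2 fun s => ?_
    by_cases hij : i = j
    · exact ae_of_all _ fun _ h => absurd hij h
    · have h0 : ∀ z, bpLaw ν {t | (t s).2 = z} = 0 := fun z => by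
        refine measure_eq_zero_iff_ae_notMem.2 ?_
        filter_upwards [ae_weight (ν := ν) (p := fun u => u ≠ z)
          (measure_eq_zero_iff_ae_notMem.1 (unifLaw_singleton z))] with t ht using ht s
      filter_upwards [ae_ne_of_noAtoms (ν.prod unifLaw) hij (f := fun t => (t s).2) (by fun_prop)
        measurable_gate h0] with t ht _ using ht
  filter_upwards [ae_offspring_pos hν0, ae_weight (ν := ν) ae_unifLaw_le_one, h3, h4]
    with t h1 h2 h3 h4 using ⟨h1, h2, h3, h4⟩

lemma sub_shift (i : ℕ) (v : List ℕ) (t : WTree) : sub i (shift v t) = shift (i :: v) t := by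
  funext u
  simp [sub, shift]

-- Best paths and general paths

lemma shift_root (v : List ℕ) (t : WTree) : shift v t [] = t v := rfl

lemma Generic.thr_le_one {t : WTree} (h : Generic t) (v : List ℕ) : thr (shift v t) ≤ 1 :=
  IPC.thr_le_one (fun _ => h.pos _) (fun _ => h.le_one _)

/-- The path that follows the best children from `u`. -/
noncomputable def bestPath (t : WTree) (u : List ℕ) : ℕ → List ℕ
  | 0 => u
  | k + 1 => best (shift (bestPath t u k) t) :: bestPath t u k

lemma next_iterate (t : WTree) (k : ℕ) : next^[k] t = shift (bestPath t [] k) t := by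
  induction k with
  | zero => funext u; simp [shift, bestPath]
  | succ k ih => rw [Function.iterate_succ_apply', ih, next, sub_shift, bestPath]

lemma Generic.thr_bestPath {t : WTree} (h : Generic t) (u : List ℕ) (k : ℕ) :
    thr (shift (bestPath t u k) t) =
      max (t (bestPath t u (k + 1))).2 (thr (shift (bestPath t u (k + 1)) t)) := by
  rw [(h.isBest _).thr_eq, sub_shift, gate, shift_root, bestPath]

lemma Generic.thr_bestPath_antitone {t : WTree} (h : Generic t) (u : List ℕ) :
    Antitone fun k => thr (shift (bestPath t u k) t) :=
  antitone_nat_of_succ_le fun k => by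
    rw [h.thr_bestPath u k]
    exact le_max_right _ _

lemma Generic.weight_bestPath_le {t : WTree} (h : Generic t) (u : List ℕ) {k m : ℕ} (hkm : k < m) :
    (t (bestPath t u m)).2 ≤ thr (shift (bestPath t u k) t) := by
  obtain ⟨m, rfl⟩ : ∃ n, m = n + 1 := ⟨m - 1, by omega⟩
  refine le_trans ?_ (h.thr_bestPath_antitone u (show k ≤ m by omega))
  simp only
  rw [h.thr_bestPath u m]
  exact le_max_left _ _

lemma Generic.bestPath_step {t : WTree} (h : Generic t) (u : List ℕ) (k : ℕ) :
    ∃ i < (t (bestPath t u k)).1, bestPath t u (k + 1) = i :: bestPath t u k :=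
  ⟨_, (h.isBest _).1, rfl⟩

/-- A path with all weights at most `p` bounds the threshold. -/
lemma thr_le_of_path {t : WTree} {p : ℝ≥0∞} {b : ℕ → List ℕ}
    (hb : ∀ k, ∃ i < (t (b k)).1, b (k + 1) = i :: b k) (hp : ∀ k, (t (b (k + 1))).2 ≤ p) :
    thr (shift (b 0) t) ≤ p := by
  refine iSup_le fun n => ?_
  induction n generalizing b with
  | zero => exact zero_le
  | succ n ih =>
    obtain ⟨i, hi, e⟩ := hb 0
    refine (Finset.inf_le (Finset.mem_range.2 hi)).trans ?_
    rw [sub_shift, ← e]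
    exact max_le (hp 0) (ih (b := fun k => b (k + 1)) (fun k => hb (k + 1)) fun k => hp (k + 1))

lemma length_of_path {b : ℕ → List ℕ} (hb : ∀ k, ∃ i : ℕ, b (k + 1) = i :: b k) (k : ℕ) :
    (b k).length = (b 0).length + k := by
  induction k with
  | zero => rfl
  | succ k ih =>
    obtain ⟨i, e⟩ := hb k
    rw [e, List.length_cons, ih]; omega

lemma suffix_of_path {b : ℕ → List ℕ} (hb : ∀ k, ∃ i : ℕ, b (k + 1) = i :: b k) {k m : ℕ}
    (hkm : k ≤ m) : b k <:+ b m := by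
  induction m, hkm using Nat.le_induction with
  | base => exact List.suffix_refl _
  | succ m _ ih =>
    obtain ⟨i, e⟩ := hb m
    rw [e]
    exact ih.trans (List.suffix_cons _ _)

/-- A path leaves every finite set that contains its origin. -/
lemma exists_exit {b : ℕ → List ℕ} (hb : ∀ k, ∃ i : ℕ, b (k + 1) = i :: b k) {S : Set (List ℕ)}
    (hS : S.Finite) (h0 : b 0 ∈ S) : ∃ m, b m ∈ S ∧ b (m + 1) ∉ S := by
  by_contra! h
  have hall : ∀ m, b m ∈ S := fun m => by
    induction m with
    | zero => exact h0
    | succ m ih => exact h m ih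
  have hinj : Function.Injective b := fun m n hmn => by
    have := congrArg List.length hmn
    rw [length_of_path hb, length_of_path hb n] at this
    omega
  exact Set.infinite_of_injective_forall_mem hinj hall hS

lemma exists_cons_suffix {v u : List ℕ} (h : v <:+ u) (hne : v ≠ u) : ∃ i, i :: v <:+ u := by
  obtain ⟨s, rfl⟩ := h
  rcases List.eq_nil_or_concat s with rfl | ⟨s', i, rfl⟩
  · simp at hne
  · exact ⟨i, s', by simp⟩

/-- Kőnig's lemma for sets of vertices that are closed under taking parents. -/
lemma exists_path_of_infinite {X : List ℕ → ℕ} {C : Set (List ℕ)}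
    (hC : ∀ i v, i :: v ∈ C → v ∈ C) (hX : ∀ i v, i :: v ∈ C → i < X v) (hinf : C.Infinite) :
    ∃ b : ℕ → List ℕ, b 0 = [] ∧ (∀ k, ∃ i : ℕ, b (k + 1) = i :: b k) ∧ ∀ k, b k ∈ C := by
  have hsuf : ∀ u ∈ C, ∀ v, v <:+ u → v ∈ C := by
    rintro _ hu v ⟨s, rfl⟩
    induction s with
    | nil => exact hu
    | cons i s ih => exact ih (hC _ _ hu)
  have step : ∀ v : {v // {u ∈ C | v <:+ u}.Infinite},
      ∃ i : ℕ, {u ∈ C | i :: v.1 <:+ u}.Infinite := by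
    rintro ⟨v, hv⟩
    by_contra! h
    refine hv ((((Set.finite_singleton v).union ((Set.finite_Iio (X v)).biUnion fun i _ =>
      h i))).subset ?_)
    rintro u ⟨hu, hvu⟩
    by_cases e : v = u
    · exact .inl e.symm
    · obtain ⟨i, hi⟩ := exists_cons_suffix hvu e
      exact .inr (Set.mem_biUnion (hX i v (hsuf u hu _ hi)) ⟨hu, hi⟩)
  choose i hi using step
  let b : ℕ → {v // {u ∈ C | v <:+ u}.Infinite} := fun k =>
    Nat.rec ⟨[], by simpa using hinf⟩ (fun _ v => ⟨i v :: v.1, hi v⟩) k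
  refine ⟨fun k => (b k).1, rfl, fun k => ⟨i (b k), rfl⟩, fun k => ?_⟩
  obtain ⟨u, hu, hs⟩ := (b k).2.nonempty
  exact hsuf u hu _ hs

-- Invaded sets, the cluster and its backbone

variable {X : List ℕ → ℕ} {w : List ℕ → ℝ}

lemma invasion_mono : Monotone (invasion X w) :=
  monotone_nat_of_le_succ fun _ => Set.subset_union_left

lemma invasion_parent {n i : ℕ} {v : List ℕ} (h : i :: v ∈ invasion X w n) :
    v ∈ invasion X w n := by
  induction n with
  | zero => simp [invasion] at h
  | succ n ih =>
    rcases h with h | h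
    · exact .inl (ih h)
    · obtain ⟨-, -, u, hu, j, e⟩ := h.1
      obtain ⟨-, rfl⟩ := List.cons.inj e
      exact .inl hu

lemma invasion_suffix {n : ℕ} {u v : List ℕ} (h : u ∈ invasion X w n) (hv : v <:+ u) :
    v ∈ invasion X w n := by
  obtain ⟨s, rfl⟩ := hv
  induction s with
  | nil => exact h
  | cons i s ih => exact ih (invasion_parent h)

lemma inTree_of_mem_invasion {n : ℕ} {v : List ℕ} (h : v ∈ invasion X w n) : InTree X v := by
  induction n with
  | zero => rw [invasion, Set.mem_singleton_iff] at h; rw [h]; trivial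
  | succ n ih =>
    rcases h with h | h
    · exact ih h
    · exact h.1.1

lemma boundary_finite {S : Set (List ℕ)} (hS : S.Finite) : (boundary X S).Finite := by
  refine (hS.biUnion fun u _ => (Set.finite_Iio (X u)).image (· :: u)).subset ?_
  rintro _ ⟨ht, -, u, hu, i, rfl⟩
  exact Set.mem_biUnion hu ⟨i, ht.2, rfl⟩

lemma invasion_finite (n : ℕ) : (invasion X w n).Finite := by
  induction n with
  | zero => exact Set.finite_singleton _
  | succ n ih => exact ih.union ((boundary_finite ih).subset fun _ h => h.1)

lemma root_mem_invasion (n : ℕ) : [] ∈ invasion X w n :=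
  invasion_mono (Nat.zero_le n) (Set.mem_singleton _)

lemma mem_cluster {v : List ℕ} : v ∈ cluster X w ↔ ∃ n, v ∈ invasion X w n := Set.mem_iUnion

lemma cluster_suffix {u v : List ℕ} (h : u ∈ cluster X w) (hv : v <:+ u) : v ∈ cluster X w := by
  obtain ⟨n, hn⟩ := mem_cluster.1 h
  exact mem_cluster.2 ⟨n, invasion_suffix hn hv⟩

lemma inTree_of_mem_cluster {v : List ℕ} (h : v ∈ cluster X w) : InTree X v := by
  obtain ⟨n, hn⟩ := mem_cluster.1 h
  exact inTree_of_mem_invasion hn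

lemma exists_mem_argminBoundary {v : List ℕ} (h : v ∈ cluster X w) (hv : v ≠ []) :
    ∃ n, v ∈ argminBoundary X w (invasion X w n) := by
  obtain ⟨n, hn⟩ := mem_cluster.1 h
  induction n with
  | zero => exact absurd hn hv
  | succ n ih =>
    rcases hn with hn | hn
    · exact ih hn
    · exact ⟨n, hn⟩

/-- A path that starts in the invaded set has an edge in its boundary. -/
lemma exists_mem_boundary {b : ℕ → List ℕ} (hb : ∀ k, ∃ i < X (b k), b (k + 1) = i :: b k) {n : ℕ}
    (h0 : b 0 ∈ invasion X w n) : ∃ m, b (m + 1) ∈ boundary X (invasion X w n) := by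
  obtain ⟨m, hm, hm'⟩ := exists_exit (fun k => (hb k).imp fun _ h => h.2) (invasion_finite n) h0
  obtain ⟨i, hi, e⟩ := hb m
  refine ⟨m, ?_, hm', b m, hm, i, e⟩
  rw [e]
  exact ⟨inTree_of_mem_invasion hm, hi⟩

/-- The edges invaded beyond `u` have weights at most the threshold of `u`. -/
lemma weight_le_thr (h : Generic (toTree X w)) {u v : List ℕ} (hv : v ∈ cluster X w)
    (huv : u <:+ v) (hne : u ≠ v) :
    ENNReal.ofReal (w v) ≤ thr (shift u (toTree X w)) := by
  have hv0 : v ≠ [] := by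
    rintro rfl
    exact hne (List.suffix_nil.1 huv)
  obtain ⟨n, hn⟩ := exists_mem_argminBoundary hv hv0
  obtain ⟨-, -, v', hv', i, rfl⟩ := hn.1
  have hu : u ∈ invasion X w n := by
    rcases List.suffix_cons_iff.1 huv with e | e
    · exact absurd e hne
    · exact invasion_suffix hv' e
  -- When `v` is invaded, the best path from `u` still offers a boundary edge of weight at most the
  -- threshold of `u`, and `v` is minimal.
  obtain ⟨m, hm⟩ := exists_mem_boundary (h.bestPath_step u) hu
  exact (ENNReal.ofReal_le_ofReal (hn.2 _ hm)).trans (h.weight_bestPath_le u (Nat.succ_pos m))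

/-- A finite cluster would be complete at some step `n`, but the boundary is then finite and
nonempty, and its minimal edge is added next. -/
lemma cluster_infinite (h : Generic (toTree X w)) : (cluster X w).Infinite := by
  intro hfin
  obtain ⟨n, hn⟩ : ∃ n, cluster X w ⊆ invasion X w n := by
    have : ∀ v ∈ cluster X w, ∃ n, v ∈ invasion X w n := fun v hv => mem_cluster.1 hv
    choose! n hn using this
    refine ⟨hfin.toFinset.sup n, fun v hv => invasion_mono ?_ (hn v hv)⟩
    exact Finset.le_sup (f := n) (hfin.mem_toFinset.2 hv)
  obtain ⟨m, hm⟩ := exists_mem_boundary (h.bestPath_step []) (root_mem_invasion (w := w) n)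
  obtain ⟨v, hv, hmin⟩ := Set.exists_min_image _ w (boundary_finite (invasion_finite n)) ⟨_, hm⟩
  exact hv.2.1 (hn (mem_cluster.2 ⟨n + 1, .inr ⟨hv, hmin⟩⟩))

/-- All edges of `b` after `b k` weigh at most the threshold of `b k`, so the gate of `b (k + 1)`
does not exceed that threshold; only the best child has such a gate. -/
lemma isBackbone_eq (h : Generic (toTree X w)) {b : ℕ → List ℕ} (hb : IsBackbone X w b) :
    b = bestPath (toTree X w) [] := by
  obtain ⟨h0, hs, hc⟩ := hb
  have hlt : ∀ k, ∃ i < X (b k), b (k + 1) = i :: b k := fun k => by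
    obtain ⟨i, e⟩ := hs k
    have := inTree_of_mem_cluster (hc (k + 1))
    rw [e] at this
    exact ⟨i, this.2, e⟩
  funext k
  induction k with
  | zero => exact h0
  | succ k ih =>
    obtain ⟨i, hi, e⟩ := hlt k
    rw [bestPath, ← ih, e]
    congr 1
    by_contra hne
    have hlt' := (h.isBest (b k)).2 i hi hne
    rw [← (h.isBest (b k)).thr_eq] at hlt'
    refine absurd hlt' (not_lt.2 ?_)
    have hle : ∀ m, k < m → ENNReal.ofReal (w (b m)) ≤ thr (shift (b k) (toTree X w)) := by
      intro m hm
      refine weight_le_thr h (hc m) (suffix_of_path hs hm.le) fun e => ?_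
      have := congrArg List.length e
      rw [length_of_path hs, length_of_path hs m] at this
      omega
    rw [sub_shift, ← e]
    refine max_le (hle _ (Nat.lt_succ_self k)) ?_
    exact thr_le_of_path (b := fun j => b (k + 1 + j)) (fun j => hlt (k + 1 + j))
      fun j => hle _ (by omega)

/-- The path through the best children is the unique infinite path in the cluster. -/
lemma isBackbone_bestPath (h : Generic (toTree X w)) :
    IsBackbone X w (bestPath (toTree X w) []) := by
  -- Existence comes from compactness: the infinite cluster contains some infinite path, which
  -- uniqueness identifies with the best path.
  obtain ⟨b, h0, hs, hc⟩ := exists_path_of_infinite (X := X) (C := cluster X w)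
    (fun i v hv => cluster_suffix hv (List.suffix_cons i v))
    (fun i v hv => (inTree_of_mem_cluster hv).2) (cluster_infinite h)
  have hb : IsBackbone X w b := ⟨h0, hs, hc⟩
  rwa [← isBackbone_eq h hb]

lemma backbone_eq (h : Generic (toTree X w)) : backbone X w = bestPath (toTree X w) [] := by
  have hex : ∃ b, IsBackbone X w b := ⟨_, isBackbone_bestPath h⟩
  rw [backbone, dif_pos hex]
  exact isBackbone_eq h hex.choose_spec

lemma bestPath_suffix_iff (h : Generic (toTree X w)) {k m : ℕ} :
    bestPath (toTree X w) [] m <:+ bestPath (toTree X w) [] k ↔ m ≤ k := by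
  have hs := (isBackbone_bestPath h).2.1
  refine ⟨fun hsuf => ?_, fun hmk => suffix_of_path hs hmk⟩
  have := hsuf.length_le
  rw [length_of_path hs, length_of_path hs k] at this
  omega

/-- An infinite cut cluster would contain an infinite path; that path is the backbone, which passes
through the excluded vertex `k + 1`. -/
lemma cut_finite (h : Generic (toTree X w)) (k : ℕ) : (cut X w k).Finite := by
  by_contra hinf
  obtain ⟨b, h0, hs, hc⟩ := exists_path_of_infinite (X := X) (C := cut X w k)
    (fun i v hv => ⟨cluster_suffix hv.1 (List.suffix_cons i v),
      fun hb => hv.2 (hb.trans (List.suffix_cons i v))⟩)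
    (fun i v hv => (inTree_of_mem_cluster hv.1).2) hinf
  have e := isBackbone_eq h ⟨h0, hs, fun k => (hc k).1⟩
  refine (hc (k + 1)).2 ?_
  rw [e, backbone_eq h]

/-- The vertices hanging off the `k`-th backbone vertex. -/
lemma mem_cluster_hanging_iff (h : Generic (toTree X w)) (k j : ℕ) (s : List ℕ)
    (hj : j ≠ best (shift (bestPath (toTree X w) [] k) (toTree X w))) :
    s ++ j :: bestPath (toTree X w) [] k ∈ cluster X w ↔
      j < X (bestPath (toTree X w) [] k) ∧
        Conn (thr (shift (bestPath (toTree X w) [] k) (toTree X w)))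
          (sub j (shift (bestPath (toTree X w) [] k) (toTree X w))) s := by
  set u := bestPath (toTree X w) [] k with hu
  have hb := isBackbone_bestPath h
  constructor
  · intro hv
    refine ⟨(inTree_of_mem_cluster (cluster_suffix hv (List.suffix_append s _))).2, ?_⟩
    have hw : ∀ s' : List ℕ, s' ++ j :: u ∈ cluster X w →
        (sub j (shift u (toTree X w)) s').2 ≤ thr (shift u (toTree X w)) := by
      intro s' hs'
      rw [sub_shift]
      refine weight_le_thr h hs' ⟨s' ++ [j], by simp⟩ fun e => ?_
      have := congrArg List.length e
      simp at this
      omega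
    induction s with
    | nil => exact hw [] hv
    | cons i s ih =>
      have hv' := cluster_suffix hv (List.suffix_cons i (s ++ j :: u))
      refine ⟨ih hv', ?_, hw _ hv⟩
      rw [sub_shift]
      exact (inTree_of_mem_cluster hv).2
  · rintro ⟨hjX, hconn⟩
    -- The path to `s` is finite, and none of its weights equals the threshold, which is the gate of
    -- a different child; so a level strictly below the threshold suffices.
    obtain ⟨z, hz, hconn'⟩ : ∃ z < thr (shift u (toTree X w)),
        Conn z (sub j (shift u (toTree X w))) s := by
      have hlt : ∀ s', (sub j (shift u (toTree X w)) s').2 ≤ thr (shift u (toTree X w)) →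
          (sub j (shift u (toTree X w)) s').2 < thr (shift u (toTree X w)) := by
        intro s' hs'
        refine lt_of_le_of_ne hs' ?_
        rw [(h.isBest u).thr_eq]
        exact h.ne_gate u _ _ s' hj
      have hmono : ∀ {z z' : ℝ≥0∞} {s' : List ℕ}, z ≤ z' →
          Conn z (sub j (shift u (toTree X w))) s' →
          Conn z' (sub j (shift u (toTree X w))) s' := by
        intro z z' s' hzz' hc
        induction s' with
        | nil => exact le_trans hc hzz'
        | cons i s' ih => exact ⟨ih hc.1, hc.2.1, hc.2.2.trans hzz'⟩
      induction s with
      | nil => exact ⟨_, hlt _ hconn, le_rfl⟩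
      | cons i s ih =>
        obtain ⟨z, hz, hc⟩ := ih hconn.1
        exact ⟨max z (sub j (shift u (toTree X w)) (i :: s)).2, max_lt hz (hlt _ hconn.2.2),
          hmono (le_max_left _ _) hc, hconn.2.1, le_max_right _ _⟩
    -- The backbone beyond `u` has an edge heavier than `z`, since otherwise the threshold would be
    -- at most `z`. When this edge is chosen, no boundary edge of weight at most `z` is left, so the
    -- path to `s` is already invaded.
    obtain ⟨m, hm⟩ : ∃ m, z < (toTree X w (bestPath (toTree X w) [] (k + m + 1))).2 := by
      by_contra! hle
      refine absurd hz (not_lt.2 ?_)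
      exact thr_le_of_path (b := fun m => bestPath (toTree X w) [] (k + m))
        (fun m => h.bestPath_step [] (k + m)) hle
    obtain ⟨n, hn⟩ := exists_mem_argminBoundary (hb.2.2 (k + m + 1)) (by simp [bestPath])
    have hun : u ∈ invasion X w n := by
      obtain ⟨-, -, u', hu', i, e⟩ := hn.1
      obtain ⟨-, rfl⟩ := List.cons.inj e
      exact invasion_suffix hu' ((bestPath_suffix_iff h).2 (by omega))
    refine mem_cluster.2 ⟨n, ?_⟩
    have key : ∀ v i, v ∈ invasion X w n → i < X v → (toTree X w (i :: v)).2 ≤ z →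
        i :: v ∈ invasion X w n := by
      intro v i hv hi hle
      by_contra hnot
      have := hn.2 (i :: v) ⟨⟨inTree_of_mem_invasion hv, hi⟩, hnot, v, hv, i, rfl⟩
      exact absurd (hm.trans_le (ENNReal.ofReal_le_ofReal this)) (not_lt.2 hle)
    clear hconn
    rw [sub_shift] at hconn'
    induction s with
    | nil => exact key u j hun hjX hconn'
    | cons i s ih => exact key _ i (ih hconn'.1) hconn'.2.1 hconn'.2.2

-- Attached forests, future maxima and weight increments

lemma mem_attached (h : Generic (toTree X w)) (k : ℕ) (v : List ℕ) :
    v ∈ attached X w k ↔ v ∈ cluster X w ∧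
    bestPath (toTree X w) [] k <:+ v ∧ ¬ bestPath (toTree X w) [] (k + 1) <:+ v := by
  cases k with
  | zero => simp [attached, cut, backbone_eq h, bestPath]
  | succ k =>
    simp only [attached, cut, backbone_eq h, Set.mem_sdiff, Set.mem_ofPred_eq]
    tauto

lemma mem_attached_ne_iff (h : Generic (toTree X w)) (k : ℕ) (v : List ℕ) :
    v ∈ attached X w k ∧ v ≠ backbone X w k ↔
      ∃ j s, v = s ++ j :: bestPath (toTree X w) [] k ∧ j < X (bestPath (toTree X w) [] k) ∧
        j ≠ best (shift (bestPath (toTree X w) [] k) (toTree X w)) ∧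
        Conn (thr (shift (bestPath (toTree X w) [] k) (toTree X w)))
          (sub j (shift (bestPath (toTree X w) [] k) (toTree X w))) s := by
  rw [mem_attached h, backbone_eq h]
  constructor
  · rintro ⟨⟨hv, hs, hns⟩, hne⟩
    obtain ⟨j, s, rfl⟩ := exists_cons_suffix hs (Ne.symm hne)
    have hj : j ≠ best (shift (bestPath (toTree X w) [] k) (toTree X w)) := by
      rintro rfl
      exact hns (List.suffix_append _ _)
    have := (mem_cluster_hanging_iff h k j s hj).1 hv
    exact ⟨j, s, rfl, this.1, hj, this.2⟩
  · rintro ⟨j, s, rfl, hjX, hj, hc⟩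
    refine ⟨⟨(mem_cluster_hanging_iff h k j s hj).2 ⟨hjX, hc⟩, ⟨s ++ [j], by simp⟩, ?_⟩, ?_⟩
    · rintro ⟨s', e⟩
      rw [bestPath, List.append_cons, List.append_cons s] at e
      have := List.append_inj_left' e rfl
      have := List.append_inj_right' this rfl
      simp_all
    · intro e
      have := congrArg List.length e
      simp at this
      omega

lemma forestWeight_eq (h : Generic (toTree X w)) (hw : ∀ v, 0 ≤ w v) (k : ℕ) :
    forestWeight X w k = (forest (next^[k] (toTree X w))).toReal := by
  classical
  set t := toTree X w with ht
  set u := bestPath t [] k with hu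
  let A : Set (List ℕ) := {v | v ∈ attached X w k ∧ v ≠ backbone X w k}
  have e1 : forestWeight X w k = (∑' v : A, (t v).2).toReal := by
    have hfin : ∀ v : A, (t v).2 ≠ ⊤ := fun v => ENNReal.ofReal_ne_top
    rw [ENNReal.tsum_toReal_eq hfin]
    exact tsum_congr fun v => (ENNReal.toReal_ofReal (hw v)).symm
  rw [e1, next_iterate, tsum_subtype A fun v => (t v).2]
  congr 1
  -- Descendants of `u` are coded by the child `j` of `u` and the position `s` below it, which
  -- matches the double sum in `forest`.
  let g : ℕ × List ℕ → List ℕ := fun p => p.2 ++ p.1 :: u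
  have hg : Function.Injective g := by
    rintro ⟨j, s⟩ ⟨j', s'⟩ e
    simp only [g] at e
    rw [List.append_cons, List.append_cons s'] at e
    have e1 := List.append_inj_left' e rfl
    have := List.append_inj_left' e1 rfl
    have := List.append_inj_right' e1 rfl
    simp_all
  have hsupp : Function.support (A.indicator fun v => (t v).2) ⊆ Set.range g := by
    intro v hv
    have hvA : v ∈ A := by
      by_contra hn
      exact hv (Set.indicator_of_notMem hn _)
    obtain ⟨j, s, e, -⟩ := (mem_attached_ne_iff h k v).1 hvA
    exact ⟨(j, s), e.symm⟩
  rw [← hg.tsum_eq hsupp, ENNReal.tsum_prod', forest, hangingWeight,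
    tsum_eq_sum (s := Finset.range (shift u t []).1)]
  · refine Finset.sum_congr rfl fun j hj => ?_
    split_ifs with hjb
    · rw [ENNReal.tsum_eq_zero]
      intro s
      refine Set.indicator_of_notMem (fun hA => ?_) _
      obtain ⟨j', s', e, -, hj', -⟩ := (mem_attached_ne_iff h k _).1 hA
      obtain ⟨rfl, rfl⟩ := Prod.mk.inj (hg (a₁ := (j, s)) (a₂ := (j', s')) e)
      exact hj' hjb
    · rw [clusterWeight]
      refine tsum_congr fun s => ?_
      have hiff : g (j, s) ∈ A ↔ Conn (thr (shift u t)) (sub j (shift u t)) s := by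
        rw [show g (j, s) ∈ A ↔ _ from mem_attached_ne_iff h k _]
        constructor
        · rintro ⟨j', s', e, -, -, hc⟩
          obtain ⟨rfl, rfl⟩ := Prod.mk.inj (hg (a₁ := (j, s)) (a₂ := (j', s')) e)
          exact hc
        · exact fun hc => ⟨j, s, rfl, Finset.mem_range.1 hj, hjb, hc⟩
      rw [Set.indicator_apply]
      simp only [hiff]
      rw [sub_shift]
      rfl
  · intro j hj
    rw [ENNReal.tsum_eq_zero]
    intro s
    refine Set.indicator_of_notMem (fun hA => ?_) _
    obtain ⟨j', s', e, hX, -⟩ := (mem_attached_ne_iff h k _).1 hA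
    obtain ⟨rfl, rfl⟩ := Prod.mk.inj (hg (a₁ := (j, s)) (a₂ := (j', s')) e)
    exact hj (Finset.mem_range.2 hX)

/-- The threshold bounds all later backbone weights. Conversely, the backbone is itself an infinite
path, so any bound on its later weights bounds the threshold. -/
lemma futureMax_eq (h : Generic (toTree X w)) (hw : ∀ v, 0 ≤ w v) (k : ℕ) :
    futureMax X w k = (thresholds (toTree X w) k).toReal := by
  rw [futureMax, backbone_eq h, thresholds, next_iterate]
  have hfin : thr (shift (bestPath (toTree X w) [] k) (toTree X w)) ≠ ⊤ :=
    ((h.thr_le_one _).trans_lt ENNReal.one_lt_top).ne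
  refine IsLUB.csSup_eq ⟨?_, ?_⟩ ⟨_, Set.mem_image_of_mem _ (Set.mem_Ioi.2 (Nat.lt_succ_self k))⟩
  · rintro _ ⟨i, hi, rfl⟩
    exact (ENNReal.ofReal_le_iff_le_toReal hfin).1 (h.weight_bestPath_le [] hi)
  · intro p hp
    have hp' : ∀ i, k < i → w (bestPath (toTree X w) [] i) ≤ p := fun i hi => hp ⟨i, hi, rfl⟩
    have hp0 : 0 ≤ p := (hw _).trans (hp' (k + 1) (Nat.lt_succ_self k))
    refine ENNReal.toReal_le_of_le_ofReal hp0 ?_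
    exact thr_le_of_path (b := fun m => bestPath (toTree X w) [] (k + m))
      (fun m => h.bestPath_step [] (k + m)) fun m => ENNReal.ofReal_le_ofReal (hp' _ (by omega))

lemma B_zero_eq (h : Generic (toTree X w)) : B X w 0 = forestWeight X w 0 := by
  have e : backbone X w 0 = [] := by rw [backbone_eq h]; rfl
  have hs : {v | v ∈ cut X w 0 ∧ v ≠ []} = {v | v ∈ attached X w 0 ∧ v ≠ backbone X w 0} := by
    rw [e, attached]
  exact tsum_congr_set_coe w hs

/-- The next cut cluster adds, disjointly, the backbone vertex `k + 1`, which carries the backbone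
edge, and the forest attached to it. Finiteness of the cut clusters makes the sums additive. -/
lemma B_succ_eq (h : Generic (toTree X w)) (hw : ∀ v, 0 ≤ w v) (k : ℕ) :
    B X w (k + 1) = (next^[k + 1] (toTree X w) []).2.toReal + forestWeight X w (k + 1) := by
  have hb := isBackbone_bestPath h
  set b := bestPath (toTree X w) [] with hbdef
  let C : ℕ → Set (List ℕ) := fun k => {v | v ∈ cut X w k ∧ v ≠ []}
  let A : Set (List ℕ) := {v | v ∈ attached X w (k + 1) ∧ v ≠ backbone X w (k + 1)}
  have hCfin : ∀ k, (C k).Finite := fun k => (cut_finite h k).subset fun _ hv => hv.1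
  have hAfin : A.Finite := (cut_finite h (k + 1)).subset fun _ hv => hv.1.1
  have hcut : ∀ k v, v ∈ cut X w k ↔ v ∈ cluster X w ∧ ¬ b (k + 1) <:+ v := fun k v => by
    rw [cut, backbone_eq h]; rfl
  have hne : b (k + 1) ≠ [] := by simp [b, bestPath]
  have hsuf : b (k + 1) <:+ b (k + 2) := suffix_of_path hb.2.1 (by omega)
  have hU : C (k + 1) = C k ∪ ({b (k + 1)} ∪ A) := by
    ext v
    simp only [C, A, Set.mem_union, Set.mem_ofPred_eq, Set.mem_singleton_iff, mem_attached h,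
      hcut, backbone_eq h, ← hbdef]
    constructor
    · rintro ⟨⟨hv, h2⟩, h0⟩
      by_cases h1 : b (k + 1) <:+ v
      · by_cases e : v = b (k + 1)
        · exact .inr (.inl e)
        · exact .inr (.inr ⟨⟨hv, h1, h2⟩, e⟩)
      · exact .inl ⟨⟨hv, h1⟩, h0⟩
    · rintro (⟨⟨hv, h1⟩, h0⟩ | rfl | ⟨⟨hv, h1, h2⟩, -⟩)
      · exact ⟨⟨hv, fun h2 => h1 (hsuf.trans h2)⟩, h0⟩
      · exact ⟨⟨hb.2.2 _, fun h2 => by have := (bestPath_suffix_iff h).1 h2; omega⟩, hne⟩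
      · refine ⟨⟨hv, h2⟩, ?_⟩
        rintro rfl
        exact hne (List.suffix_nil.1 h1)
  have hd1 : Disjoint {b (k + 1)} A := by
    rw [Set.disjoint_singleton_left]
    intro hA
    exact hA.2 (by rw [backbone_eq h])
  have hd2 : Disjoint (C k) ({b (k + 1)} ∪ A) := by
    rw [Set.disjoint_left]
    rintro v ⟨hv, -⟩ (hv' | ⟨hv', -⟩)
    · rw [Set.mem_singleton_iff] at hv'
      rw [hv'] at hv
      exact ((hcut k _).1 hv).2 (List.suffix_refl _)
    · exact ((hcut k _).1 hv).2 ((mem_attached h _ _).1 hv').2.1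
  have hs : ∀ {S : Set (List ℕ)}, S.Finite → Summable (w ∘ ((↑) : S → List ℕ)) := fun hS => by
    have := hS.to_subtype
    exact Summable.of_finite
  have e1 : cutWeight X w (k + 1) = ∑' v : (C (k + 1) : Set (List ℕ)), w v := rfl
  have e2 : cutWeight X w k = ∑' v : (C k : Set (List ℕ)), w v := rfl
  have e3 : forestWeight X w (k + 1) = ∑' v : (A : Set (List ℕ)), w v := rfl
  have e4 : (next^[k + 1] (toTree X w) []).2.toReal = w (b (k + 1)) := by
    rw [next_iterate]
    exact ENNReal.toReal_ofReal (hw _)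
  rw [B, e1, e2, e3, e4, hU, Summable.tsum_union_disjoint hd2 (hs (hCfin k))
    (hs ((Set.finite_singleton _).union hAfin)),
    Summable.tsum_union_disjoint hd1 (hs (Set.finite_singleton _)) (hs hAfin), tsum_singleton]
  ring

end Deterministic

/-! ### Conditional independence along the backbone -/

section Conclusion

set_option linter.unusedSectionVars false

/-- The thresholds along the backbone as real numbers. -/
noncomputable def realThresholds (t : WTree) (k : ℕ) : ℝ := (thresholds t k).toReal

/-- The weights of the forest (`false`) at the `k`-th backbone vertex and of the backbone edge
(`true`) that leads to it. -/
noncomputable def pieces (t : WTree) : ℕ × Bool → ℝ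
  | (k, false) => (forest (next^[k] t)).toReal
  | (0, true) => 0
  | (k + 1, true) => (next^[k + 1] t []).2.toReal

/-- The conditional probability that `pieces t p ∈ A`, given the thresholds. -/
noncomputable def pieceProb (ν : Measure ℕ) : ℕ × Bool → Set ℝ → (ℕ → ℝ) → ℝ≥0∞
  | (k, false), A, z => forestMean ν (fun x => A.indicator 1 x.toReal) (ENNReal.ofReal (z k))
  | (0, true), A, _ => A.indicator 1 0
  | (k + 1, true), A, z => edgeMean (fun x => A.indicator 1 x.toReal) (ENNReal.ofReal (z k))
      (ENNReal.ofReal (z (k + 1)))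

lemma measurable_realThresholds : Measurable realThresholds :=
  measurable_pi_iff.2 fun k =>
    ((measurable_pi_apply k).comp measurable_thresholds).ennreal_toReal

lemma measurable_pieces : Measurable pieces := by
  refine measurable_pi_iff.2 ?_
  rintro ⟨k, _ | _⟩
  · simp only [pieces]
    exact (measurable_forest.comp (measurable_next.iterate k)).ennreal_toReal
  · cases k with
    | zero => exact measurable_const
    | succ k =>
      simp only [pieces]
      exact (measurable_snd.comp ((measurable_pi_apply []).comp
        (measurable_next.iterate (k + 1)))).ennreal_toReal

lemma measurable_indicator_toReal {A : Set ℝ} (hA : MeasurableSet A) :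
    Measurable fun x : ℝ≥0∞ => A.indicator (1 : ℝ → ℝ≥0∞) x.toReal :=
  (measurable_one.indicator hA).comp ENNReal.measurable_toReal

variable {ν : Measure ℕ} [IsProbabilityMeasure ν]

lemma measurable_pieceProb (p : ℕ × Bool) {A : Set ℝ} (hA : MeasurableSet A) :
    Measurable (pieceProb ν p A) := by
  rcases p with ⟨k, _ | _⟩
  · exact (measurable_forestMean (measurable_indicator_toReal hA)).comp
      (f := fun z : ℕ → ℝ => ENNReal.ofReal (z k)) (by fun_prop)
  · cases k with
    | zero => exact measurable_const
    | succ k =>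
      exact (measurable_edgeMean (measurable_indicator_toReal hA)).comp
        (f := fun z : ℕ → ℝ => (ENNReal.ofReal (z k), ENNReal.ofReal (z (k + 1)))) (by fun_prop)

lemma pieceProb_univ (p : ℕ × Bool) (z : ℕ → ℝ) :
    pieceProb ν p Set.univ z = 1 := by
  rcases p with ⟨k, _ | _⟩
  · simpa [pieceProb] using forestMean_one _
  · cases k with
    | zero => simp [pieceProb]
    | succ k => simpa [pieceProb] using edgeMean_one _ _

/-- Brings a product over an arbitrary finite `S` into the shape of `obsProd`, where the forest at
`i` is paired with the edge leading to `i + 1`; the trivial piece `(0, true)` stays apart, and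
untested pieces get `Set.univ`. -/
lemma prod_pieces {M : Type*} [CommMonoid M] (F : ℕ × Bool → Set ℝ → M)
    (hF : ∀ p, F p Set.univ = 1) (S : Finset (ℕ × Bool)) (A A' : ℕ × Bool → Set ℝ)
    (hA : ∀ p ∈ S, A' p = A p) (hA' : ∀ p ∉ S, A' p = Set.univ) {n : ℕ}
    (hn : ∀ p ∈ S, p.1 < n) :
    ∏ p ∈ S, F p (A p) = F (0, true) (A' (0, true)) *
      ∏ i ∈ Finset.range n, F (i, false) (A' (i, false)) * F (i + 1, true) (A' (i + 1, true)) := by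
  have hsub : S ⊆ Finset.range (n + 1) ×ˢ Finset.univ := fun p hp =>
    Finset.mem_product.2 ⟨Finset.mem_range.2 (by have := hn p hp; omega), Finset.mem_univ _⟩
  rw [Finset.prod_congr rfl fun p hp => by rw [← hA p hp],
    Finset.prod_subset hsub fun p _ hp => by rw [hA' p hp, hF], Finset.prod_product]
  simp only [Fintype.prod_bool]
  rw [Finset.prod_mul_distrib, Finset.prod_range_succ', Finset.prod_range_succ
    (fun i => F (i, false) (A' (i, false))), hA' (n, false) fun h => lt_irrefl _ (hn _ h), hF,
    Finset.prod_mul_distrib, mul_one, mul_comm (∏ i ∈ Finset.range n, F (i + 1, true) _), mul_assoc,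
    mul_comm (∏ i ∈ Finset.range n, F (i + 1, true) _)]

lemma prod_indicator_eq {ι : Type*} (S : Finset ι) (A : ι → Set ℝ) (y : ι → ℝ) :
    ∏ p ∈ S, (A p).indicator (1 : ℝ → ℝ≥0∞) (y p) =
      (Set.pi (S : Set ι) A).indicator (1 : (ι → ℝ) → ℝ≥0∞) y := by
  by_cases h : y ∈ Set.pi (S : Set ι) A
  · rw [Set.indicator_of_mem h]
    exact Finset.prod_eq_one fun p hp => Set.indicator_of_mem (h p hp) _
  · rw [Set.indicator_of_notMem h]
    simp only [Set.mem_pi, not_forall] at h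
    obtain ⟨p, hp, hp'⟩ := h
    exact Finset.prod_eq_zero hp (Set.indicator_of_notMem hp' _)

lemma measure_pieces (hν0 : ν {0} = 0) (hν2 : ν {x | 2 ≤ x} ≠ 0) (S : Finset (ℕ × Bool))
    (A : ℕ × Bool → Set ℝ) (hA : ∀ p, MeasurableSet (A p)) (D : Set (ℕ → ℝ))
    (hD : MeasurableSet D) :
    bpLaw ν (realThresholds ⁻¹' D ∩ pieces ⁻¹' (Set.pi S A)) =
      ∫⁻ t in realThresholds ⁻¹' D, ∏ p ∈ S, pieceProb ν p (A p) (realThresholds t) ∂bpLaw ν := by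
  classical
  let A' : ℕ × Bool → Set ℝ := fun p => if p ∈ S then A p else Set.univ
  have hA1 : ∀ p ∈ S, A' p = A p := fun p hp => if_pos hp
  have hA2 : ∀ p ∉ S, A' p = Set.univ := fun p hp => if_neg hp
  have hAm : ∀ p, MeasurableSet (A' p) := fun p => by
    by_cases hp : p ∈ S
    · rw [hA1 p hp]; exact hA p
    · rw [hA2 p hp]; exact .univ
  obtain ⟨n, hn⟩ : ∃ n, ∀ p ∈ S, p.1 < n :=
    ⟨S.sup Prod.fst + 1, fun p hp => Nat.lt_succ_of_le (Finset.le_sup (f := Prod.fst) hp)⟩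
  let f : ℕ → ℝ≥0∞ → ℝ≥0∞ := fun i x => (A' (i, false)).indicator 1 x.toReal
  let g : ℕ → ℝ≥0∞ → ℝ≥0∞ := fun i x => (A' (i + 1, true)).indicator 1 x.toReal
  have hmD : MeasurableSet (realThresholds ⁻¹' D) := measurable_realThresholds hD
  have hmV : MeasurableSet (pieces ⁻¹' (Set.pi (S : Set (ℕ × Bool)) A)) :=
    measurable_pieces (.pi S.countable_toSet fun p _ => hA p)
  -- Carries the event `D` and the constant factor of the piece `(0, true)`, which `obsProd` does
  -- not contain.
  let Φ : (ℕ → ℝ≥0∞) → ℝ≥0∞ := fun z =>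
    D.indicator 1 (fun k => (z k).toReal) * (A' (0, true)).indicator 1 0
  have hΦ : Measurable Φ := by
    refine Measurable.mul ((measurable_one.indicator hD).comp ?_) measurable_const
    exact measurable_pi_iff.2 fun k => (measurable_pi_apply k).ennreal_toReal
  have hcomm := lintegral_obsProd hν0 hν2 n (f := f) (g := g)
    (fun i => measurable_indicator_toReal (hAm _)) (fun i => measurable_indicator_toReal (hAm _))
    (fun i x => Set.indicator_le_self' (fun _ _ => zero_le) _) hΦ
  have hL : bpLaw ν (realThresholds ⁻¹' D ∩ pieces ⁻¹' (Set.pi S A)) =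
      ∫⁻ t, Φ (thresholds t) * obsProd f g n t ∂bpLaw ν := by
    rw [← lintegral_indicator_one (hmD.inter hmV)]
    refine lintegral_congr fun t => ?_
    have e1 := prod_pieces (fun p A => A.indicator (1 : ℝ → ℝ≥0∞) (pieces t p)) (by simp) S A A'
      hA1 hA2 hn
    rw [prod_indicator_eq] at e1
    have e2 : (realThresholds ⁻¹' D ∩ pieces ⁻¹' (Set.pi (S : Set (ℕ × Bool)) A)).indicator
        (1 : WTree → ℝ≥0∞) t = D.indicator 1 (realThresholds t) *
          (Set.pi (S : Set (ℕ × Bool)) A).indicator 1 (pieces t) := by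
      rw [Set.inter_indicator_one]
      rfl
    rw [e2, e1, ← mul_assoc]
    rfl
  have hR : ∫⁻ t, Φ (thresholds t) * meanProd ν f g n (thresholds t) ∂bpLaw ν =
      ∫⁻ t in realThresholds ⁻¹' D, ∏ p ∈ S, pieceProb ν p (A p) (realThresholds t) ∂bpLaw ν := by
    rw [← lintegral_indicator hmD]
    refine lintegral_congr_ae ?_
    filter_upwards [ae_generic hν0 hν2] with t ht
    -- On generic trees the thresholds are at most one, so passing to real numbers loses nothing.
    have hfin : ∀ k, ENNReal.ofReal (realThresholds t k) = thresholds t k := fun k => by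
      refine ENNReal.ofReal_toReal ?_
      rw [thresholds, next_iterate]
      exact ((ht.thr_le_one _).trans_lt ENNReal.one_lt_top).ne
    have e1 := prod_pieces (fun p A => pieceProb ν p A (realThresholds t))
      (fun p => pieceProb_univ p _) S A A' hA1 hA2 hn
    have e2 : (realThresholds ⁻¹' D).indicator
        (fun t => ∏ p ∈ S, pieceProb ν p (A p) (realThresholds t)) t =
        D.indicator (1 : (ℕ → ℝ) → ℝ≥0∞) (realThresholds t) *
          ∏ p ∈ S, pieceProb ν p (A p) (realThresholds t) := by
      by_cases hmem : realThresholds t ∈ D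
      · rw [Set.indicator_of_mem hmem,
          Set.indicator_of_mem (show t ∈ realThresholds ⁻¹' D from hmem),
          Pi.one_apply, one_mul]
      · rw [Set.indicator_of_notMem hmem,
          Set.indicator_of_notMem (show t ∉ realThresholds ⁻¹' D from hmem), zero_mul]
    rw [e2, e1, ← mul_assoc]
    refine congrArg₂ _ rfl (Finset.prod_congr rfl fun i _ => ?_)
    simp only [pieceProb, hfin]
    rfl
  rw [hL, hcomm, hR]

/-- Given the thresholds along the backbone, functions of the pieces at distinct backbone vertices
are independent. -/
lemma condIndepGiven_pieces (hν0 : ν {0} = 0) (hν2 : ν {x | 2 ≤ x} ≠ 0)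
    (ψ : ℕ → (Bool → ℝ) → ℝ) (hψ : ∀ k, Measurable (ψ k)) :
    CondIndepGiven (bpLaw ν) (fun t k => ψ k fun j => pieces t (k, j)) realThresholds :=
  condIndepGiven_of_blocks _ measurable_pieces measurable_realThresholds
    (ae_iIndepFun_condDistrib _ measurable_pieces measurable_realThresholds (pieceProb ν)
      (fun p _ hA => measurable_pieceProb p hA) (measure_pieces hν0 hν2)) ψ hψ

/-- The regular conditional law is built from the joint law of the pair alone, and that law is
unaffected by transport along `T` and by changes on null sets. -/
lemma CondIndepGiven.comp_of_map {Ω Ω' : Type*} [MeasurableSpace Ω] [MeasurableSpace Ω']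
    {P : Measure Ω} [IsFiniteMeasure P] {Q : Measure Ω'} [IsFiniteMeasure Q] {T : Ω → Ω'}
    (hT : Measurable T) (hPQ : P.map T = Q) {Y Z : Ω' → ℕ → ℝ} (h : CondIndepGiven Q Y Z)
    {Y' Z' : Ω → ℕ → ℝ} (hY : Y' =ᵐ[P] Y ∘ T) (hZ : Z' =ᵐ[P] Z ∘ T) :
    CondIndepGiven P Y' Z' := by
  subst hPQ
  obtain ⟨hYm, hZm, hc⟩ := h
  refine ⟨(hYm.comp_measurable hT).congr hY.symm, (hZm.comp_measurable hT).congr hZ.symm, ?_⟩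
  have e1 : P.map Z' = (P.map T).map Z := by
    rw [Measure.map_congr hZ, AEMeasurable.map_map_of_aemeasurable hZm hT.aemeasurable]
  have e2 : condDistrib Y' Z' P = condDistrib Y Z (P.map T) := by
    rw [condDistrib_congr hY hZ, condDistrib, condDistrib]
    congr 1
    rw [AEMeasurable.map_map_of_aemeasurable (hZm.prodMk hYm) hT.aemeasurable]
    rfl
  rw [e1, e2]
  exact hc

lemma map_toTree {Ω : Type*} [MeasurableSpace Ω] {P : Measure Ω} [IsProbabilityMeasure P]
    {X : List ℕ → Ω → ℕ} {w : List ℕ → Ω → ℝ} (hT : IsWeightedBPTree P ν X w) :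
    P.map (fun ω => toTree (fun v => X v ω) fun v => w v ω) = bpLaw ν := by
  have hY : ∀ v, Measurable fun ω => ENNReal.ofReal (w v ω) := fun v =>
    (hT.measurable_weight v).ennreal_ofReal
  have iY : iIndepFun (fun v ω => ENNReal.ofReal (w v ω)) P :=
    hT.indep_weight.comp (fun _ => ENNReal.ofReal) fun _ => ENNReal.measurable_ofReal
  have hXY : IndepFun (fun ω v => X v ω) (fun ω v => ENNReal.ofReal (w v ω)) P :=
    hT.indep.comp (φ := id) (ψ := fun (y : List ℕ → ℝ) v => ENNReal.ofReal (y v)) measurable_id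
      (by fun_prop)
  have hind := iIndepFun_prodMk hT.measurable_offspring hY hT.indep_offspring iY hXY
  have hm : ∀ v, Measurable fun ω => (X v ω, ENNReal.ofReal (w v ω)) := fun v =>
    (hT.measurable_offspring v).prodMk (hY v)
  have e := (iIndepFun_iff_map_fun_eq_infinitePi_map hm).1 hind
  have e2 : ∀ v, P.map (fun ω => (X v ω, ENNReal.ofReal (w v ω))) = ν.prod unifLaw := fun v => by
    have hv : IndepFun (X v) (fun ω => ENNReal.ofReal (w v ω)) P :=
      hXY.comp (measurable_pi_apply v) (measurable_pi_apply v)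
    rw [(indepFun_iff_map_prod_eq_prod_map_map (hT.measurable_offspring v).aemeasurable
      (hY v).aemeasurable).1 hv, hT.law_offspring v, unifLaw, ← hT.law_weight v,
      Measure.map_map ENNReal.measurable_ofReal (hT.measurable_weight v)]
    rfl
  simp only [e2] at e
  exact e

end Conclusion

end IPC

-- The theorem

theorem corollary1p3 {Ω : Type*} [MeasurableSpace Ω] (P : Measure Ω) [IsProbabilityMeasure P]
    (ν : Measure ℕ) [IsProbabilityMeasure ν] (hν₀ : ν {0} = 0)
    (α c : ℝ) (hα : 0 < α) (hc : 0 < c)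
    (hν : (fun x : ℝ => ν.real {n : ℕ | x < (n : ℝ)}) ~[atTop] fun x : ℝ => c * x ^ (-α))
    (X : List ℕ → Ω → ℕ) (w : List ℕ → Ω → ℝ) (hT : IPC.IsWeightedBPTree P ν X w) :
    (∀ᵐ ω ∂P, (∃! b : ℕ → List ℕ, IPC.IsBackbone (fun v => X v ω) (fun v => w v ω) b) ∧
      ∀ k, (IPC.cut (fun v => X v ω) (fun v => w v ω) k).Finite) ∧
    IPC.CondIndepGiven P
      (fun ω k => IPC.B (fun v => X v ω) (fun v => w v ω) k)
      (fun ω k => IPC.futureMax (fun v => X v ω) (fun v => w v ω) k) ∧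
    IPC.CondIndepGiven P
      (fun ω k => IPC.forestWeight (fun v => X v ω) (fun v => w v ω) k)
      (fun ω k => IPC.futureMax (fun v => X v ω) (fun v => w v ω) k) := by
  -- The tail is asymptotic to a positive function, hence nonzero at some `x ≥ 1`, and an integer
  -- above such an `x` is at least `2`.
  have hν2 : ν {x | 2 ≤ x} ≠ 0 := by
    have hpos : ∀ᶠ x : ℝ in atTop, c * x ^ (-α) ≠ 0 := by
      filter_upwards [eventually_gt_atTop 0] with x hx
      exact (mul_pos hc (Real.rpow_pos_of_pos hx _)).ne'
    obtain ⟨u, hu, he⟩ := hν.exists_eq_mul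
    have hu0 : ∀ᶠ x in atTop, u x ≠ 0 := hu.eventually_ne one_ne_zero
    obtain ⟨x, hx1, hx2, hx3, hx4⟩ :=
      (hpos.and (hu0.and (he.and (eventually_ge_atTop (1 : ℝ))))).exists
    intro h0
    have hle : ν {n : ℕ | x < (n : ℝ)} = 0 := by
      refine measure_mono_null (fun n hn => ?_) h0
      have : (1 : ℝ) < n := lt_of_le_of_lt hx4 hn
      exact_mod_cast this
    have : ν.real {n : ℕ | x < (n : ℝ)} ≠ 0 := by
      refine hx3.trans_ne ?_
      exact mul_ne_zero hx2 hx1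
    exact this (by rw [measureReal_def, hle, ENNReal.toReal_zero])
  set T : Ω → IPC.WTree := fun ω => IPC.toTree (fun v => X v ω) fun v => w v ω with hTdef
  have hTm : Measurable T := measurable_pi_iff.2 fun v =>
    (hT.measurable_offspring v).prodMk (hT.measurable_weight v).ennreal_ofReal
  have hmap : P.map T = IPC.bpLaw ν := IPC.map_toTree hT
  have hgen : ∀ᵐ ω ∂P, IPC.Generic (T ω) := by
    have := IPC.ae_generic hν₀ hν2
    rw [← hmap] at this
    exact ae_of_ae_map hTm.aemeasurable this
  have hw : ∀ᵐ ω ∂P, ∀ v, 0 ≤ w v ω := by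
    refine ae_all_iff.2 fun v => ?_
    have : ∀ᵐ x ∂P.map (w v), 0 ≤ x := by
      rw [hT.law_weight v]
      filter_upwards [ae_restrict_mem measurableSet_Icc] with x hx using hx.1
    exact ae_of_ae_map (hT.measurable_weight v).aemeasurable this
  have hZ : (fun ω k => IPC.futureMax (fun v => X v ω) (fun v => w v ω) k) =ᵐ[P]
      IPC.realThresholds ∘ T := by
    filter_upwards [hgen, hw] with ω h1 h2
    funext k
    exact IPC.futureMax_eq h1 h2 k
  refine ⟨?_, ?_, ?_⟩
  · filter_upwards [hgen] with ω h
    exact ⟨⟨_, IPC.isBackbone_bestPath h, fun b hb => IPC.isBackbone_eq h hb⟩, IPC.cut_finite h⟩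
  · refine IPC.CondIndepGiven.comp_of_map hTm hmap
      -- Each increment is the backbone edge plus the forest of one block; at the root the edge
      -- piece is `0`.
      (IPC.condIndepGiven_pieces hν₀ hν2 (fun _ y => y true + y false) fun _ => by fun_prop) ?_ hZ
    filter_upwards [hgen, hw] with ω h1 h2
    funext k
    cases k with
    | zero =>
      rw [IPC.B_zero_eq h1, IPC.forestWeight_eq h1 h2]
      simp [IPC.pieces, T]
    | succ k =>
      rw [IPC.B_succ_eq h1 h2, IPC.forestWeight_eq h1 h2]
      rfl
  · refine IPC.CondIndepGiven.comp_of_map hTm hmap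
      (IPC.condIndepGiven_pieces hν₀ hν2 (fun _ y => y false) fun _ => by fun_prop) ?_ hZ
    filter_upwards [hgen, hw] with ω h1 h2
    funext k
    exact IPC.forestWeight_eq h1 h2 k
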